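/- Let $\beta\approx 0.745$ be Kertz's constant, i.e. the unique $\beta\in(0,1)$ with $$\int_0^1\bigl[(\beta^{-1}-1)-y(\log y-1)\bigr]^{-1}\,dy=1 .$$ There is an absolute constant $C>0$ such that the following holds. Let $\varepsilon,\delta\ge 0$ be reals, let $n\ge 0$ be an integer, and let $\mathbf X=(X_1,\dots,X_n)$ be independent (not necessarily identically distributed) random variables with values in $[0,\infty)$, all of them $(\varepsilon,\delta)$-small, meaning $\Pr(X_i>\delta)\le\varepsilon$ for every $i$. The variables are presented in a uniformly random order $\sigma$ that is independent of their values: at step $k$ the identity $\sigma(k)$ and the value $X_{\sigma(k)}$ are revealed. A stopping rule is a stopping time $\tau$ with respect to the information revealed so far; its expected reward is $\mathbb E[X_{\sigma(\tau)}]$, where the reward is $0$ if it never stops. Let $\mathsf{OPT}(\mathbf X)$ be the supremum of the expected rewards of all stopping rules, and let $\mathsf{MAX}(\mathbf X)=\mathbb E[\max_i X_i]$ (equal to $0$ if $n=0$). Then $$\mathsf{OPT}(\mathbf X)\ \ge\ (\beta-C\varepsilon)\cdot\mathsf{MAX}(\mathbf X)-\delta ,$$ and moreover some stopping rule $\tau$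 satisfies $\mathbb E[X_{\sigma(\tau)}]\ge(\beta-C\varepsilon)\cdot\mathsf{MAX}(\mathbf X)-\delta$. (Expectations take values in $[0,\infty]$; if $\beta-C\varepsilon\le 0$ the inequalities hold trivially.) -/

import Mathlib

open MeasureTheory ProbabilityTheory
open scoped NNReal ENNReal

/-! ### Kertz's constant -/

/-- `β ∈ (0, 1)` solves Kertz's equation
`∫₀¹ [(β⁻¹ - 1) - y (log y - 1)]⁻¹ dy = 1`. For `β ∈ (0, 1)` the integrand is positive and
continuous on `[0, 1]`. -/
def SolvesKertz (β : ℝ) : Prop :=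
  0 < β ∧ β < 1 ∧ ∫ y in (0 : ℝ)..1, ((β⁻¹ - 1) - y * (Real.log y - 1))⁻¹ = 1

lemma kertz_aux_nonneg {y : ℝ} (h0 : 0 ≤ y) (h1 : y ≤ 1) : 0 ≤ -(y * (Real.log y - 1)) := by
  have := Real.log_nonpos h0 h1
  nlinarith

lemma kertz_aux_continuous : Continuous fun y : ℝ => -(y * (Real.log y - 1)) := by
  have h : (fun y : ℝ => -(y * (Real.log y - 1))) = fun y => y - y * Real.log y := by
    funext y; ring
  rw [h]
  exact continuous_id.sub Real.continuous_mul_log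

lemma kertz_aux_le {y s : ℝ} (h0 : 0 ≤ y) (hs0 : 0 < s) (hs : s ≤ 1) (hy : y ≤ s ^ 2) :
    -(y * (Real.log y - 1)) ≤ 2 * s - s ^ 2 := by
  rcases h0.eq_or_lt with rfl | hpos
  · simp; nlinarith
  have hq : 0 < √y := Real.sqrt_pos.2 hpos
  have hqy : √y ^ 2 = y := Real.sq_sqrt h0
  have hqs : √y ≤ s := Real.sqrt_le_iff.2 ⟨hs0.le, hy⟩
  have hl : Real.log (√y)⁻¹ ≤ (√y)⁻¹ - 1 := Real.log_le_sub_one_of_pos (inv_pos.2 hq)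
  rw [Real.log_inv, Real.log_sqrt h0] at hl
  have h2 : y * (-Real.log y) ≤ y * (2 * ((√y)⁻¹ - 1)) :=
    mul_le_mul_of_nonneg_left (by linarith) h0
  have h3 : y * (√y)⁻¹ = √y := by
    nth_rewrite 1 [← hqy]
    field_simp
  nlinarith

lemma kertz_integrand_continuousOn {c : ℝ} (hc : 0 < c) :
    ContinuousOn (fun y : ℝ => (c - y * (Real.log y - 1))⁻¹) (Set.Icc 0 1) := by
  refine ContinuousOn.inv₀ ?_ ?_
  · have h : (fun y : ℝ => c - y * (Real.log y - 1)) = fun y => c + -(y * (Real.log y - 1)) := by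
      funext y; ring
    rw [h]
    exact (continuous_const.add kertz_aux_continuous).continuousOn
  · intro y hy
    have := kertz_aux_nonneg hy.1 hy.2
    linarith

lemma kertz_integral_strictAnti {c d : ℝ} (hc : 0 < c) (hcd : c < d) :
    ∫ y in (0 : ℝ)..1, (d - y * (Real.log y - 1))⁻¹ <
      ∫ y in (0 : ℝ)..1, (c - y * (Real.log y - 1))⁻¹ := by
  have key : ∀ y ∈ Set.Icc (0 : ℝ) 1,
      (d - y * (Real.log y - 1))⁻¹ < (c - y * (Real.log y - 1))⁻¹ := by
    intro y hy
    have := kertz_aux_nonneg hy.1 hy.2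
    exact inv_strictAnti₀ (by linarith) (by linarith)
  exact intervalIntegral.integral_lt_integral_of_continuousOn_of_le_of_exists_lt zero_lt_one
    (kertz_integrand_continuousOn (hc.trans hcd)) (kertz_integrand_continuousOn hc)
    (fun y hy => (key y ⟨hy.1.le, hy.2⟩).le) ⟨0, by simp, key 0 (by simp)⟩

/-- Kertz's equation has exactly one solution in `(0, 1)`. -/
theorem existsUnique_solvesKertz : ∃! β : ℝ, SolvesKertz β := by
  have hex : ∃ c : ℝ, 0 < c ∧ ∫ y in (0 : ℝ)..1, (c - y * (Real.log y - 1))⁻¹ = 1 := by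
    set G : ℝ → ℝ := fun c => ∫ y in (0 : ℝ)..1,
      (max c (1 / 100) + max 0 (-(y * (Real.log y - 1))))⁻¹ with hG
    have hGc : Continuous G := by
      refine intervalIntegral.continuous_parametric_intervalIntegral_of_continuous' ?_ 0 1
      refine Continuous.inv₀ ?_ ?_
      · exact (continuous_fst.max continuous_const).add
          (continuous_const.max (kertz_aux_continuous.comp continuous_snd))
      · rintro ⟨c, y⟩
        have h1 : (1 / 100 : ℝ) ≤ max c (1 / 100) := le_max_right _ _
        have h2 : (0 : ℝ) ≤ max 0 (-(y * (Real.log y - 1))) := le_max_left _ _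
        have h3 : 0 < max c (1 / 100) + max 0 (-(y * (Real.log y - 1))) := by linarith
        exact h3.ne'
    have hGeq : ∀ c : ℝ, 1 / 100 ≤ c →
        G c = ∫ y in (0 : ℝ)..1, (c - y * (Real.log y - 1))⁻¹ := by
      intro c hc
      refine intervalIntegral.integral_congr fun y hy => ?_
      rw [Set.uIcc_of_le zero_le_one] at hy
      rw [max_eq_left hc, max_eq_right (kertz_aux_nonneg hy.1 hy.2), ← sub_eq_add_neg]
    have hint : ∀ c : ℝ, 0 < c → ∀ a b : ℝ, 0 ≤ a → a ≤ b → b ≤ 1 →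
        IntervalIntegrable (fun y : ℝ => (c - y * (Real.log y - 1))⁻¹) volume a b := by
      intro c hc a b ha hab hb
      exact ((kertz_integrand_continuousOn hc).mono
        (Set.Icc_subset_Icc ha hb)).intervalIntegrable_of_Icc hab
    have hhi : G 1 ≤ 1 := by
      rw [hGeq 1 (by norm_num)]
      have := intervalIntegral.integral_mono_on (μ := volume) (a := 0) (b := 1)
        (f := fun y : ℝ => (1 - y * (Real.log y - 1))⁻¹) (g := fun _ => (1 : ℝ)) zero_le_one
        (hint 1 one_pos 0 1 le_rfl zero_le_one le_rfl) (by simp) (by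
          intro y hy
          have := kertz_aux_nonneg hy.1 hy.2
          exact inv_le_one_of_one_le₀ (by linarith))
      simpa using this
    have hpiece : ∀ a b s : ℝ, 0 ≤ a → a ≤ b → b ≤ 1 → 0 < s → s ≤ 1 → b ≤ s ^ 2 →
        (b - a) * (1 / 100 + (2 * s - s ^ 2))⁻¹ ≤
          ∫ y in a..b, ((1 / 100 : ℝ) - y * (Real.log y - 1))⁻¹ := by
      intro a b s ha hab hb hs0 hs hbs
      have := intervalIntegral.integral_mono_on (μ := volume) (a := a) (b := b)
        (f := fun _ => (1 / 100 + (2 * s - s ^ 2) : ℝ)⁻¹)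
        (g := fun y : ℝ => ((1 / 100 : ℝ) - y * (Real.log y - 1))⁻¹) hab
        (by simp) (hint _ (by norm_num) a b ha hab hb) (by
          intro y hy
          have h1 := kertz_aux_nonneg (ha.trans hy.1) (hy.2.trans hb)
          have h2 := kertz_aux_le (ha.trans hy.1) hs0 hs (hy.2.trans hbs)
          exact inv_anti₀ (by linarith) (by linarith))
      simpa using this
    have hlo : 1 ≤ G (1 / 100) := by
      rw [hGeq _ le_rfl, ← intervalIntegral.integral_add_adjacent_intervals
        (hint _ (by norm_num) 0 (1 / 4) le_rfl (by norm_num) (by norm_num))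
        (hint _ (by norm_num) (1 / 4) 1 (by norm_num) (by norm_num) le_rfl)]
      have h1 := hpiece 0 (1 / 4) (1 / 2) le_rfl (by norm_num) (by norm_num) (by norm_num)
        (by norm_num) (by norm_num)
      have h2 := hpiece (1 / 4) 1 1 (by norm_num) (by norm_num) le_rfl (by norm_num) le_rfl
        (by norm_num)
      norm_num at h1 h2 ⊢
      linarith
    obtain ⟨c, hc, hGv⟩ := intermediate_value_Icc' (by norm_num : (1 / 100 : ℝ) ≤ 1)
      hGc.continuousOn ⟨hhi, hlo⟩
    exact ⟨c, by linarith [hc.1], by rw [← hGeq c hc.1]; exact hGv⟩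
  obtain ⟨c, hc, hint⟩ := hex
  refine ⟨(1 + c)⁻¹, ⟨by positivity, inv_lt_one_of_one_lt₀ (by linarith), ?_⟩, ?_⟩
  · simpa using hint
  · rintro β ⟨h0, h1, hβ⟩
    have hb : 0 < β⁻¹ - 1 := by linarith [(one_lt_inv₀ h0).2 h1]
    have : β⁻¹ - 1 = c := by
      rcases lt_trichotomy (β⁻¹ - 1) c with h | h | h
      · have := kertz_integral_strictAnti hb h
        linarith
      · exact h
      · have := kertz_integral_strictAnti hc h
        linarith
    rw [← this]
    simp

/-- Kertz's constant `β ≈ 0.745`, the unique solution of Kertz's equation. -/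
noncomputable def kertzConstant : ℝ := existsUnique_solvesKertz.choose

theorem solvesKertz_kertzConstant : SolvesKertz kertzConstant :=
  existsUnique_solvesKertz.choose_spec.1

/-! ### The random-order prophet problem -/

section Prophet

variable {n : ℕ} {Ω : Type*} [MeasurableSpace Ω]

/-- A nonnegative random variable `X` is `(ε, δ)`-small if `P(X > δ) ≤ ε`. -/
def IsSmall (ε δ : ℝ≥0) (X : Ω → ℝ≥0) (μ : Measure Ω) : Prop :=
  μ {ω | δ < X ω} ≤ ε

instance Equiv.Perm.measurableSpaceFin : MeasurableSpace (Equiv.Perm (Fin n)) := ⊤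

/-- The law of the arrival order together with the values: the order is a uniformly random
permutation of the boxes, independent of the values. In the outcome `(σ, ω)` the `k`-th box to
arrive is `σ k`. -/
noncomputable def randomOrder (n : ℕ) (μ : Measure Ω) : Measure (Equiv.Perm (Fin n) × Ω) :=
  (PMF.uniformOfFintype (Equiv.Perm (Fin n))).toMeasure.prod μ

/-- What is revealed at step `k`: the identity and the value of the `k`-th box to arrive. -/
def observation (X : Fin n → Ω → ℝ≥0) (k : Fin n) (p : Equiv.Perm (Fin n) × Ω) : Fin n × ℝ≥0 :=
  (p.1 k, X (p.1 k) p.2)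

lemma measurable_observation {X : Fin n → Ω → ℝ≥0} (hX : ∀ i, Measurable (X i)) (k : Fin n) :
    Measurable (observation X k) :=
  measurable_from_prod_countable_right fun σ =>
    (measurable_const (a := σ k)).prodMk (hX (σ k))

/-- The information available online: after step `k` the gambler knows the identities and the
values of the first `k + 1` boxes (those with index `j ≤ k`), and nothing else. -/
def onlineFiltration (X : Fin n → Ω → ℝ≥0) (hX : ∀ i, Measurable (X i)) :
    Filtration (Fin n) (inferInstance : MeasurableSpace (Equiv.Perm (Fin n) × Ω)) :=
  Filtration.natural (observation X) fun k => (measurable_observation hX k).stronglyMeasurable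

/-- The value collected in the outcome `p` when stopping at `t`; `t = ⊤` means that every box has
been rejected. -/
def payoff (X : Fin n → Ω → ℝ≥0) (p : Equiv.Perm (Fin n) × Ω) : WithTop (Fin n) → ℝ≥0
  | none => 0
  | some k => X (p.1 k) p.2

/-- The expected reward of `τ` when the boxes arrive in uniformly random order. -/
noncomputable def expectedReward (X : Fin n → Ω → ℝ≥0) (μ : Measure Ω)
    (τ : Equiv.Perm (Fin n) × Ω → WithTop (Fin n)) : ℝ≥0∞ :=
  ∫⁻ p, payoff X p (τ p) ∂(randomOrder n μ)

/-- `OPT(X)`: the optimal expected reward of an online stopping rule in random order. -/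
noncomputable def prophetOPT (X : Fin n → Ω → ℝ≥0) (hX : ∀ i, Measurable (X i))
    (μ : Measure Ω) : ℝ≥0∞ :=
  ⨆ (τ : Equiv.Perm (Fin n) × Ω → WithTop (Fin n)) (_ : IsStoppingTime (onlineFiltration X hX) τ),
    expectedReward X μ τ

/-- `MAX(X) = E[max_i X_i]`, the reward of the prophet. -/
noncomputable def prophetMAX (X : Fin n → Ω → ℝ≥0) (μ : Measure Ω) : ℝ≥0∞ :=
  ∫⁻ ω, ⨆ i, (X i ω : ℝ≥0∞) ∂μ

end Prophet

/-! ### The density attached to Kertz's constant -/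

/-! Give every box an independent level `y` in `(0, 1)` with density `1 / kertzRate`, let boxes of
higher level arrive first, and accept a box when its value exceeds the `y`-quantile of the maximum.
Kertz's equation says precisely that this density has total mass one.

Reachability: each box blocks independently, so the probability that level `y` is reached is a
product over boxes. By Jensen, each factor is at least the exponential of its mean logarithm.
Summing over boxes gives the logarithm of the joint probability below the `z`-quantile, which is
`log z`. Thus `y` is reached with probability at least `exp (∫ z in y..1, log z / kertzRate z)`. As
the derivative of `kertzRate` is `-log`, this equals `β * kertzRate y`
(`ofReal_mul_kertzRate_le_prod_lintegral_passProb`). The factor `kertzRate` cancels the density, so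
all levels count with the same weight `β dy`.

Reward: let `F` be the distribution function of the maximum. If each box is nonzero with probability
at most `ε`, the sum of its tail probabilities is at least `(1 - ε) * (-log F)`. Since `-log (max y
(F u))` integrates over `y` to `1 - F u`, integrating over `u` as well yields `β * (1 - ε)` times
the expected maximum (`ofReal_mul_lintegral_jointReal_le`).

Three points remain. Atoms: at a quantile that is an atom, a second random choice between the closed
and the open segment makes the mean log-probability exactly `log y`. Derandomization: some fixed
vector of marks is as good as the average, and once sorted it is a list of thresholds indexed by
arrival position (`exists_stoppingTime_of_marks`). General `δ`: apply the result to the truncated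
differences `X i - δ`. -/

/-- The reciprocal of the integrand in Kertz's equation. -/
noncomputable def kertzRate (y : ℝ) : ℝ := (kertzConstant⁻¹ - 1) - y * (Real.log y - 1)

lemma kertzConstant_pos : 0 < kertzConstant := solvesKertz_kertzConstant.1

lemma kertzConstant_lt_one : kertzConstant < 1 := solvesKertz_kertzConstant.2.1

lemma inv_kertzConstant_sub_one_pos : 0 < kertzConstant⁻¹ - 1 := by
  linarith [(one_lt_inv₀ kertzConstant_pos).2 kertzConstant_lt_one]

lemma kertzRate_pos {y : ℝ} (h0 : 0 ≤ y) (h1 : y ≤ 1) : 0 < kertzRate y := by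
  have := kertz_aux_nonneg h0 h1
  have := inv_kertzConstant_sub_one_pos
  unfold kertzRate
  linarith

lemma kertzRate_one : kertzRate 1 = kertzConstant⁻¹ := by
  simp [kertzRate]

lemma continuous_kertzRate : Continuous kertzRate := by
  have h : kertzRate = fun y => (kertzConstant⁻¹ - 1) + -(y * (Real.log y - 1)) := by
    funext y; unfold kertzRate; ring
  rw [h]
  exact continuous_const.add kertz_aux_continuous

lemma hasDerivAt_kertzRate {y : ℝ} (hy : y ≠ 0) : HasDerivAt kertzRate (-Real.log y) y := by
  have h := ((hasDerivAt_id y).mul ((Real.hasDerivAt_log hy).sub_const 1)).const_sub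
    (kertzConstant⁻¹ - 1)
  refine h.congr_deriv ?_
  simp only [id]
  field_simp
  ring

/-- The integrand is the derivative of `-log kertzRate`, and `kertzRate 1 = β⁻¹`. This is the lower
bound for the probability of reaching level `y`. -/
lemma exp_integral_log_div_kertzRate {y : ℝ} (h0 : 0 < y) (h1 : y ≤ 1) :
    Real.exp (∫ z in y..1, Real.log z / kertzRate z) = kertzConstant * kertzRate y := by
  have hz : ∀ z ∈ Set.uIcc y 1, 0 < z ∧ 0 < kertzRate z := by
    intro z hz
    rw [Set.uIcc_of_le h1] at hz
    exact ⟨h0.trans_le hz.1, kertzRate_pos (h0.le.trans hz.1) hz.2⟩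
  have hint : ∫ z in y..1, Real.log z / kertzRate z
      = -Real.log (kertzRate 1) - -Real.log (kertzRate y) := by
    refine intervalIntegral.integral_eq_sub_of_hasDerivAt
      (f := fun z => -Real.log (kertzRate z)) ?_ ?_
    · intro z hz'
      have := ((hasDerivAt_kertzRate (hz z hz').1.ne').log (hz z hz').2.ne').neg
      refine this.congr_deriv ?_
      ring
    · refine ContinuousOn.intervalIntegrable ?_
      refine ContinuousOn.div ?_ continuous_kertzRate.continuousOn fun z hz' => (hz z hz').2.ne'
      exact Real.continuousOn_log.mono fun z hz' => (hz z hz').1.ne'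
  have hy := kertzRate_pos h0.le h1
  rw [hint, kertzRate_one, Real.log_inv, neg_neg, sub_neg_eq_add, Real.exp_add,
    Real.exp_log kertzConstant_pos, Real.exp_log hy]

/-- Kertz's equation in the form that normalizes the law of the levels. -/
lemma lintegral_inv_kertzRate :
    ∫⁻ y in Set.Ioo (0 : ℝ) 1, ENNReal.ofReal (kertzRate y)⁻¹ = 1 := by
  have h := solvesKertz_kertzConstant.2.2
  rw [intervalIntegral.integral_of_le zero_le_one, integral_Ioc_eq_integral_Ioo] at h
  rw [← ofReal_integral_eq_lintegral_ofReal]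
  · change ENNReal.ofReal (∫ y in Set.Ioo (0 : ℝ) 1,
      ((kertzConstant⁻¹ - 1) - y * (Real.log y - 1))⁻¹) = 1
    rw [h, ENNReal.ofReal_one]
  · exact ((kertz_integrand_continuousOn inv_kertzConstant_sub_one_pos).integrableOn_Icc).mono_set
      Set.Ioo_subset_Icc_self
  · filter_upwards [ae_restrict_mem measurableSet_Ioo] with y hy
    exact (inv_pos.2 (kertzRate_pos hy.1.le hy.2.le)).le

/-- With `c` the probability that the maximum is at most `u`, the right side is its tail at `u`:
averaging over levels turns log-probabilities into the tail of the maximum. -/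
lemma lintegral_neg_log_max {c : ℝ} (h0 : 0 < c) (h1 : c ≤ 1) :
    ∫⁻ y in Set.Ioo (0 : ℝ) 1, ENNReal.ofReal (-Real.log (max y c)) = ENNReal.ofReal (1 - c) := by
  have hcont : Continuous fun y : ℝ => -Real.log (max y c) :=
    ((continuous_id.max continuous_const).log fun y => (h0.trans_le (le_max_right y c)).ne').neg
  rw [← ofReal_integral_eq_lintegral_ofReal]
  · congr 1
    rw [← integral_Ioc_eq_integral_Ioo, ← intervalIntegral.integral_of_le zero_le_one,
      ← intervalIntegral.integral_add_adjacent_intervals (b := c)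
        (hcont.intervalIntegrable 0 c) (hcont.intervalIntegrable c 1)]
    have e1 : ∫ y in (0 : ℝ)..c, -Real.log (max y c) = ∫ y in (0 : ℝ)..c, -Real.log c := by
      refine intervalIntegral.integral_congr fun y hy => ?_
      rw [Set.uIcc_of_le h0.le] at hy
      simp only [max_eq_right hy.2]
    have e2 : ∫ y in c..1, -Real.log (max y c) = ∫ y in c..1, -Real.log y := by
      refine intervalIntegral.integral_congr fun y hy => ?_
      rw [Set.uIcc_of_le h1] at hy
      simp only [max_eq_left hy.1]
    rw [e1, e2, intervalIntegral.integral_const, intervalIntegral.integral_neg, integral_log]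
    simp
    ring
  · exact (hcont.integrableOn_Icc).mono_set Set.Ioo_subset_Icc_self
  · filter_upwards [ae_restrict_mem measurableSet_Ioo] with y hy
    have : Real.log (max y c) ≤ 0 :=
      Real.log_nonpos (hy.1.le.trans (le_max_left _ _)) (max_le hy.2.le h1)
    simpa using this

/-! ### Stopping at the first acceptable observation -/

section FirstHit

variable {n : ℕ} {Ω : Type*}

open Classical in
/-- The first step `k` at which the observation lies in `A k`. -/
noncomputable def firstHit (X : Fin n → Ω → ℝ≥0) (A : Fin n → Set (Fin n × ℝ≥0))
    (p : Equiv.Perm (Fin n) × Ω) : WithTop (Fin n) :=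
  (Finset.univ.filter fun k => observation X k p ∈ A k).min

lemma firstHit_le_iff {X : Fin n → Ω → ℝ≥0} {A : Fin n → Set (Fin n × ℝ≥0)}
    {p : Equiv.Perm (Fin n) × Ω} {k : Fin n} :
    firstHit X A p ≤ k ↔ ∃ j ≤ k, observation X j p ∈ A j := by
  classical
  unfold firstHit
  constructor
  · intro h
    obtain ⟨j, hj⟩ := WithTop.ne_top_iff_exists.1 (h.trans_lt (WithTop.coe_lt_top k)).ne
    refine ⟨j, ?_, ?_⟩
    · rw [← hj] at h
      exact WithTop.coe_le_coe.1 h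
    · simpa using Finset.mem_of_min hj.symm
  · rintro ⟨j, hjk, hj⟩
    exact (Finset.min_le (by simpa using hj)).trans (WithTop.coe_le_coe.2 hjk)

lemma firstHit_eq_coe {X : Fin n → Ω → ℝ≥0} {A : Fin n → Set (Fin n × ℝ≥0)}
    {p : Equiv.Perm (Fin n) × Ω} {k : Fin n} (hk : observation X k p ∈ A k)
    (h : ∀ j < k, observation X j p ∉ A j) : firstHit X A p = k := by
  refine le_antisymm (firstHit_le_iff.2 ⟨k, le_rfl, hk⟩) (not_lt.1 fun hlt => ?_)
  obtain ⟨j, hj⟩ := WithTop.ne_top_iff_exists.1 (hlt.trans (WithTop.coe_lt_top k)).ne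
  obtain ⟨i, hij, hi⟩ := firstHit_le_iff.1 hj.ge
  rw [← hj] at hlt
  exact h i (hij.trans_lt (WithTop.coe_lt_coe.1 hlt)) hi

variable [MeasurableSpace Ω]

lemma measurable_observation_onlineFiltration {X : Fin n → Ω → ℝ≥0} (hX : ∀ i, Measurable (X i))
    {j k : Fin n} (hjk : j ≤ k) : Measurable[onlineFiltration X hX k] (observation X j) := by
  refine Measurable.mono (comap_measurable _) ?_ le_rfl
  exact le_iSup₂_of_le j hjk le_rfl

lemma isStoppingTime_firstHit {X : Fin n → Ω → ℝ≥0} (hX : ∀ i, Measurable (X i))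
    {A : Fin n → Set (Fin n × ℝ≥0)} (hA : ∀ k, MeasurableSet (A k)) :
    IsStoppingTime (onlineFiltration X hX) (firstHit X A) := by
  intro k
  have : {p | firstHit X A p ≤ k} = ⋃ j, ⋃ (_ : j ≤ k), observation X j ⁻¹' A j := by
    ext p
    simp [firstHit_le_iff]
  rw [this]
  exact MeasurableSet.iUnion fun j => MeasurableSet.iUnion fun hj =>
    measurable_observation_onlineFiltration hX hj (hA j)

/-- Observing `f (X i)` reveals no more than observing `X i`; needed for the truncation `x ↦ x - δ`.
-/
lemma isStoppingTime_of_comp {X : Fin n → Ω → ℝ≥0} (hX : ∀ i, Measurable (X i)) {f : ℝ≥0 → ℝ≥0}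
    (hf : Measurable f) (hfX : ∀ i, Measurable fun ω => f (X i ω))
    {τ : Equiv.Perm (Fin n) × Ω → WithTop (Fin n)}
    (hτ : IsStoppingTime (onlineFiltration (fun i ω => f (X i ω)) hfX) τ) :
    IsStoppingTime (onlineFiltration X hX) τ := by
  intro k
  refine (iSup₂_le fun j hj => ?_ :
    onlineFiltration (fun i ω => f (X i ω)) hfX k ≤ onlineFiltration X hX k) _ (hτ k)
  refine Measurable.comap_le ?_
  exact (measurable_id.prodMap hf).comp (measurable_observation_onlineFiltration hX hj)

lemma lintegral_randomOrder {μ : Measure Ω} [SFinite μ] {G : Equiv.Perm (Fin n) → Ω → ℝ≥0∞}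
    (hG : ∀ σ, Measurable (G σ)) :
    ∫⁻ p, G p.1 p.2 ∂(randomOrder n μ)
      = ∑ σ, (∫⁻ ω, G σ ω ∂μ) * (Fintype.card (Equiv.Perm (Fin n)) : ℝ≥0∞)⁻¹ := by
  have hm : Measurable fun p : Equiv.Perm (Fin n) × Ω => G p.1 p.2 :=
    measurable_from_prod_countable_right hG
  unfold randomOrder
  rw [lintegral_prod _ hm.aemeasurable, lintegral_fintype]
  refine Finset.sum_congr rfl fun σ _ => ?_
  rw [PMF.toMeasure_apply_singleton _ _ (MeasurableSet.singleton σ), PMF.uniformOfFintype_apply]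

/-- Waiting for box `i` earns its expectation. -/
lemma exists_stoppingTime_lintegral_le {X : Fin n → Ω → ℝ≥0} (hX : ∀ i, Measurable (X i))
    (μ : Measure Ω) [SFinite μ] (i : Fin n) :
    ∃ τ, IsStoppingTime (onlineFiltration X hX) τ ∧ ∫⁻ ω, X i ω ∂μ ≤ expectedReward X μ τ := by
  refine ⟨firstHit X fun _ => {i} ×ˢ Set.univ, isStoppingTime_firstHit hX fun _ =>
    (measurableSet_singleton i).prod MeasurableSet.univ, ?_⟩
  have h := lintegral_randomOrder (n := n) (μ := μ) (G := fun _ ω => (X i ω : ℝ≥0∞))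
    fun _ => (hX i).coe_nnreal_ennreal
  rw [Finset.sum_const, Finset.card_univ, nsmul_eq_mul, mul_left_comm, ENNReal.mul_inv_cancel
    (by simp [Fintype.card_ne_zero]) (ENNReal.natCast_ne_top _), mul_one] at h
  rw [← h]
  refine lintegral_mono fun p => ?_
  have : firstHit X (fun _ => {i} ×ˢ Set.univ) p = (p.1.symm i : Fin n) := by
    refine firstHit_eq_coe (by simp [observation]) fun j hj hmem => hj.ne ?_
    simp only [observation, Set.mem_prod, Set.mem_singleton_iff] at hmem
    simp [← hmem.1]
  rw [this]
  change (X i p.2 : ℝ≥0∞) ≤ (X (p.1 (p.1.symm i)) p.2 : ℝ≥0)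
  simp

end FirstHit

/-! ### Stopping rules from independent marks -/

section Marks

variable {n : ℕ} {Ω 𝓜 : Type*}

open Classical in
/-- The reward of a box of value `x` and mark `a` if it is accepted. -/
noncomputable def markReward (Acc : Set (𝓜 × ℝ≥0)) (a : 𝓜) (x : ℝ≥0) : ℝ≥0∞ :=
  if (a, x) ∈ Acc then x else 0

open Classical in
/-- Whether a box of value `x` and mark `b` leaves a box of mark `a` reachable, that is, whether it
is ranked after `a` or is rejected. -/
noncomputable def markPass (rank : 𝓜 → ℝ) (Acc : Set (𝓜 × ℝ≥0)) (a b : 𝓜) (x : ℝ≥0) : ℝ≥0∞ :=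
  if rank b ≤ rank a ∧ (b, x) ∈ Acc then 0 else 1

/-- The value of box `i` if it is the first accepted one in the order of the ranks. -/
noncomputable def markGain (rank : 𝓜 → ℝ) (Acc : Set (𝓜 × ℝ≥0)) (m : Fin n → 𝓜)
    (x : Fin n → ℝ≥0) (i : Fin n) : ℝ≥0∞ :=
  markReward Acc (m i) (x i) * ∏ j ∈ Finset.univ.erase i, markPass rank Acc (m i) (m j) (x j)

lemma markPass_le_one (rank : 𝓜 → ℝ) (Acc : Set (𝓜 × ℝ≥0)) (a b : 𝓜) (x : ℝ≥0) :
    markPass rank Acc a b x ≤ 1 := by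
  unfold markPass
  split_ifs <;> simp

lemma markReward_le (Acc : Set (𝓜 × ℝ≥0)) (a : 𝓜) (x : ℝ≥0) : markReward Acc a x ≤ x := by
  unfold markReward
  split_ifs <;> simp

lemma mem_of_markGain_ne_zero {rank : 𝓜 → ℝ} {Acc : Set (𝓜 × ℝ≥0)} {m : Fin n → 𝓜}
    {x : Fin n → ℝ≥0} {i : Fin n} (h : markGain rank Acc m x i ≠ 0) : (m i, x i) ∈ Acc := by
  by_contra hn
  exact h (by simp [markGain, markReward, hn])

lemma notMem_of_markGain_ne_zero {rank : 𝓜 → ℝ} {Acc : Set (𝓜 × ℝ≥0)} {m : Fin n → 𝓜}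
    {x : Fin n → ℝ≥0} {i j : Fin n} (h : markGain rank Acc m x i ≠ 0) (hji : j ≠ i)
    (hr : rank (m j) ≤ rank (m i)) : (m j, x j) ∉ Acc := by
  intro hn
  refine h ?_
  have : ∏ j ∈ Finset.univ.erase i, markPass rank Acc (m i) (m j) (x j) = 0 :=
    Finset.prod_eq_zero (Finset.mem_erase.2 ⟨hji, Finset.mem_univ j⟩) (by simp [markPass, hn, hr])
  simp [markGain, this]

lemma markGain_le (rank : 𝓜 → ℝ) (Acc : Set (𝓜 × ℝ≥0)) (m : Fin n → 𝓜) (x : Fin n → ℝ≥0)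
    (i : Fin n) : markGain rank Acc m x i ≤ x i :=
  calc _ ≤ (x i : ℝ≥0∞) * 1 := by
        refine mul_le_mul' (markReward_le _ _ _) (Finset.prod_le_one' fun j _ => ?_)
        exact markPass_le_one _ _ _ _ _
    _ = x i := mul_one _

/-- Marks are attached to arrival positions, so box `j` carries the mark of position `p.1.symm j`.
Of two accepted boxes, the one of larger rank has gain zero, and on a tie both do; hence at most one
summand survives. Its box is the first hit because the ranks increase with the position. -/
lemma sum_markGain_le_payoff {rank : 𝓜 → ℝ} {Acc : Set (𝓜 × ℝ≥0)} {m : Fin n → 𝓜}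
    (hm : Monotone (rank ∘ m)) (X : Fin n → Ω → ℝ≥0) (p : Equiv.Perm (Fin n) × Ω) :
    ∑ i, markGain rank Acc (fun j => m (p.1.symm j)) (fun j => X j p.2) i
      ≤ payoff X p (firstHit X (fun k => {q | (m k, q.2) ∈ Acc}) p) := by
  by_cases h0 : ∀ i, markGain rank Acc (fun j => m (p.1.symm j)) (fun j => X j p.2) i = 0
  · simp [h0]
  push Not at h0
  obtain ⟨i, hi⟩ := h0
  have hmem := mem_of_markGain_ne_zero hi
  have hsingle : ∑ i, markGain rank Acc (fun j => m (p.1.symm j)) (fun j => X j p.2) i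
      = markGain rank Acc (fun j => m (p.1.symm j)) (fun j => X j p.2) i := by
    refine Finset.sum_eq_single i (fun j _ hji => ?_) (by simp)
    by_contra hj
    rcases le_total (rank (m (p.1.symm j))) (rank (m (p.1.symm i))) with h | h
    · exact notMem_of_markGain_ne_zero hi hji h (mem_of_markGain_ne_zero hj)
    · exact notMem_of_markGain_ne_zero hj hji.symm h hmem
  have hτ : firstHit X (fun k => {q | (m k, q.2) ∈ Acc}) p = (p.1.symm i : Fin n) := by
    refine firstHit_eq_coe ?_ fun k hk => ?_
    · simpa [observation] using hmem
    · have hne : p.1 k ≠ i := fun h => hk.ne (by simp [← h])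
      have := notMem_of_markGain_ne_zero hi hne (by simpa using hm hk.le)
      simpa [observation] using this
  rw [hsingle, hτ]
  change _ ≤ ((X (p.1 (p.1.symm i)) p.2 : ℝ≥0) : ℝ≥0∞)
  rw [Equiv.apply_symm_apply]
  exact markGain_le _ _ _ _ _

/-! ### Measurability, derandomization and factorization of the gain. -/

variable [MeasurableSpace Ω] [MeasurableSpace 𝓜]

lemma measurable_markReward {Acc : Set (𝓜 × ℝ≥0)} (hAcc : MeasurableSet Acc) :
    Measurable fun q : 𝓜 × ℝ≥0 => markReward Acc q.1 q.2 :=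
  Measurable.ite hAcc measurable_snd.coe_nnreal_ennreal measurable_const

lemma measurable_markPass {rank : 𝓜 → ℝ} (hrank : Measurable rank) {Acc : Set (𝓜 × ℝ≥0)}
    (hAcc : MeasurableSet Acc) :
    Measurable fun q : 𝓜 × 𝓜 × ℝ≥0 => markPass rank Acc q.1 q.2.1 q.2.2 := by
  refine Measurable.ite ?_ measurable_const measurable_const
  exact (measurableSet_le (hrank.comp (measurable_fst.comp measurable_snd))
    (hrank.comp measurable_fst)).inter (measurable_snd hAcc)

lemma measurable_markGain {rank : 𝓜 → ℝ} (hrank : Measurable rank) {Acc : Set (𝓜 × ℝ≥0)}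
    (hAcc : MeasurableSet Acc) {X : Fin n → Ω → ℝ≥0} (hX : ∀ i, Measurable (X i)) (i : Fin n) :
    Measurable fun q : (Fin n → 𝓜) × Ω => markGain rank Acc q.1 (fun j => X j q.2) i := by
  have h1 : ∀ j, Measurable fun q : (Fin n → 𝓜) × Ω => q.1 j := fun j =>
    (measurable_pi_apply j).comp measurable_fst
  have h2 : ∀ j, Measurable fun q : (Fin n → 𝓜) × Ω => X j q.2 := fun j =>
    (hX j).comp measurable_snd
  refine Measurable.mul ((measurable_markReward hAcc).comp ((h1 i).prodMk (h2 i))) ?_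
  exact Finset.measurable_prod _ fun j _ =>
    (measurable_markPass hrank hAcc).comp ((h1 i).prodMk ((h1 j).prodMk (h2 j)))

/-- Independent identically distributed marks produce a stopping rule for the random order that
does at least as well as the average of `markGain`. -/
theorem exists_stoppingTime_of_marks {rank : 𝓜 → ℝ} (hrank : Measurable rank)
    {Acc : Set (𝓜 × ℝ≥0)} (hAcc : MeasurableSet Acc) {X : Fin n → Ω → ℝ≥0}
    (hX : ∀ i, Measurable (X i)) (μ : Measure Ω) [SFinite μ] (κ : Measure 𝓜)
    [IsProbabilityMeasure κ]
    (hfin : ∫⁻ m, ∫⁻ ω, ∑ i, markGain rank Acc m (fun j => X j ω) i ∂μ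
      ∂(Measure.pi fun _ : Fin n => κ) ≠ ∞) :
    ∃ τ, IsStoppingTime (onlineFiltration X hX) τ ∧
      ∫⁻ m, ∫⁻ ω, ∑ i, markGain rank Acc m (fun j => X j ω) i ∂μ
        ∂(Measure.pi fun _ : Fin n => κ) ≤ expectedReward X μ τ := by
  set G : (Fin n → 𝓜) → ℝ≥0∞ :=
    fun m => ∫⁻ ω, ∑ i, markGain rank Acc m (fun j => X j ω) i ∂μ with hG
  have hmeas : Measurable fun q : (Fin n → 𝓜) × Ω =>
      ∑ i, markGain rank Acc q.1 (fun j => X j q.2) i :=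
    Finset.measurable_sum _ fun i _ => measurable_markGain hrank hAcc hX i
  have hGm : Measurable G := hmeas.lintegral_prod_right'
  set c : ℝ≥0∞ := (Fintype.card (Equiv.Perm (Fin n)) : ℝ≥0∞)⁻¹ with hc
  have hmp : ∀ σ : Equiv.Perm (Fin n), MeasurePreserving (fun m : Fin n → 𝓜 => fun j => m (σ j))
      (Measure.pi fun _ => κ) (Measure.pi fun _ => κ) := fun σ =>
    measurePreserving_arrowCongr' (fun _ => κ) (fun _ => κ) σ.symm (MeasurableEquiv.refl 𝓜)
      fun _ => MeasurePreserving.id κ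
  -- The law of independent identically distributed marks is invariant under permutations, so the
  -- uniform average over `σ` costs nothing.
  have havg : ∫⁻ m, ∑ σ : Equiv.Perm (Fin n), G (fun j => m (σ j)) * c
      ∂(Measure.pi fun _ : Fin n => κ) = ∫⁻ m, G m ∂(Measure.pi fun _ : Fin n => κ) := by
    have hGσ : ∀ σ : Equiv.Perm (Fin n), Measurable fun m : Fin n → 𝓜 => G fun j => m (σ j) :=
      fun σ => hGm.comp (hmp σ).measurable
    rw [lintegral_finsetSum _ fun σ _ => (hGσ σ).mul_const c]
    have : ∀ σ : Equiv.Perm (Fin n), ∫⁻ m, G (fun j => m (σ j)) * c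
        ∂(Measure.pi fun _ : Fin n => κ) = (∫⁻ m, G m ∂(Measure.pi fun _ : Fin n => κ)) * c := by
      intro σ
      rw [lintegral_mul_const _ (hGσ σ), (hmp σ).lintegral_comp hGm]
    simp_rw [this]
    rw [Finset.sum_const, Finset.card_univ, nsmul_eq_mul, mul_left_comm, ENNReal.mul_inv_cancel
      (by simp [Fintype.card_ne_zero]) (ENNReal.natCast_ne_top _), mul_one]
  -- Derandomization: a single mark vector, assigned to the boxes in uniformly random order, does at
  -- least as well as the mean.
  obtain ⟨m, hm⟩ := exists_lintegral_le (havg.symm ▸ hfin)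
  rw [havg] at hm
  -- Sorting leaves the average over assignments unchanged and makes the ranks increase with the
  -- arrival position.
  set s := Tuple.sort (rank ∘ m) with hs
  have hmono : Monotone (rank ∘ (m ∘ s)) := Tuple.monotone_sort (rank ∘ m)
  refine ⟨firstHit X fun k => {q | ((m ∘ s) k, q.2) ∈ Acc}, isStoppingTime_firstHit hX fun k =>
    (measurable_const.prodMk measurable_snd) hAcc, hm.trans ?_⟩
  have hreindex : ∑ σ : Equiv.Perm (Fin n), G (fun j => m (σ j)) * c
      = ∑ σ : Equiv.Perm (Fin n), G (fun j => (m ∘ s) (σ.symm j)) * c := by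
    -- Substitution `σ ↦ s * σ⁻¹`.
    refine (Fintype.sum_equiv ((Equiv.inv _).trans (Equiv.mulLeft s)) _ _ fun σ => ?_).symm
    rfl
  rw [hreindex, hG, hc]
  have hsec : ∀ σ : Equiv.Perm (Fin n), Measurable fun ω =>
      ∑ i, markGain rank Acc (fun j => (m ∘ s) (σ.symm j)) (fun j => X j ω) i := fun σ =>
    hmeas.comp measurable_prodMk_left
  rw [← lintegral_randomOrder hsec]
  exact lintegral_mono fun p => sum_markGain_le_payoff hmono X p

lemma lintegral_markGain {rank : 𝓜 → ℝ} (hrank : Measurable rank) {Acc : Set (𝓜 × ℝ≥0)}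
    (hAcc : MeasurableSet Acc) {X : Fin n → Ω → ℝ≥0} (hX : ∀ i, Measurable (X i))
    {μ : Measure Ω} (hind : iIndepFun X μ) (m : Fin n → 𝓜) (i : Fin n) :
    ∫⁻ ω, markGain rank Acc m (fun j => X j ω) i ∂μ
      = (∫⁻ ω, markReward Acc (m i) (X i ω) ∂μ)
        * ∏ j ∈ Finset.univ.erase i, ∫⁻ ω, markPass rank Acc (m i) (m j) (X j ω) ∂μ := by
  classical
  -- The reward of box `i` becomes the factor of index `i`, so that the gain is one product of
  -- functions of independent variables.
  set g : Fin n → ℝ≥0 → ℝ≥0∞ := fun j x =>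
    if j = i then markReward Acc (m i) x else markPass rank Acc (m i) (m j) x with hg
  have hgm : ∀ j, Measurable (g j) := by
    intro j
    by_cases hj : j = i
    · simp only [hg, hj, if_true]
      exact (measurable_markReward hAcc).comp (measurable_prodMk_left (x := m i))
    · simp only [hg, hj, if_false]
      exact (measurable_markPass hrank hAcc).comp
        ((measurable_prodMk_left (x := m i)).comp (measurable_prodMk_left (x := m j)))
  have h := lintegral_prod_eq_prod_lintegral_of_indepFun Finset.univ (fun j ω => g j (X j ω))
    (hind.comp g hgm) fun j => (hgm j).comp (hX j)
  rw [← Finset.mul_prod_erase Finset.univ _ (Finset.mem_univ i)] at h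
  have e : ∀ ω, markGain rank Acc m (fun j => X j ω) i = ∏ j, g j (X j ω) := by
    intro ω
    rw [← Finset.mul_prod_erase Finset.univ _ (Finset.mem_univ i), markGain]
    congr 1
    · simp [hg]
    · exact Finset.prod_congr rfl fun j hj => by simp [hg, Finset.ne_of_mem_erase hj]
  simp_rw [e, h]
  congr 1
  · simp [hg]
  · exact Finset.prod_congr rfl fun j hj => by simp [hg, Finset.ne_of_mem_erase hj]

/-- Condition on the mark `a` of box `i`: the remaining marks are independent, so their product
integrates factor by factor. -/
lemma lintegral_pi_mul_prod_erase {κ : Measure 𝓜} [IsProbabilityMeasure κ] {P : 𝓜 → ℝ≥0∞}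
    (hP : Measurable P) {Q : Fin n → 𝓜 → 𝓜 → ℝ≥0∞}
    (hQ : ∀ j, Measurable fun q : 𝓜 × 𝓜 => Q j q.1 q.2) (i : Fin n) :
    ∫⁻ m, P (m i) * ∏ j ∈ Finset.univ.erase i, Q j (m i) (m j) ∂(Measure.pi fun _ : Fin n => κ)
      = ∫⁻ a, P a * ∏ j ∈ Finset.univ.erase i, ∫⁻ b, Q j a b ∂κ ∂κ := by
  obtain ⟨k, rfl⟩ : ∃ k, n = k + 1 := Nat.exists_eq_succ_of_ne_zero fun h => (h ▸ i).elim0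
  have herase : ∀ f : Fin (k + 1) → ℝ≥0∞,
      ∏ j ∈ Finset.univ.erase i, f j = ∏ j, f (i.succAbove j) := by
    intro f
    rw [Fin.univ_succAbove k i, Finset.erase_cons, Finset.prod_map]
    rfl
  simp_rw [herase]
  have hmp := measurePreserving_piFinSuccAbove (fun _ : Fin (k + 1) => κ) i
  have hF : Measurable fun q : 𝓜 × (Fin k → 𝓜) =>
      P q.1 * ∏ j, Q (i.succAbove j) q.1 (q.2 j) := by
    refine (hP.comp measurable_fst).mul (Finset.measurable_prod _ fun j _ => ?_)
    exact (hQ _).comp (measurable_fst.prodMk ((measurable_pi_apply j).comp measurable_snd))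
  have h := hmp.lintegral_comp hF
  refine Eq.trans ?_ (h.trans ?_)
  · rfl
  · rw [lintegral_prod _ hF.aemeasurable]
    refine lintegral_congr fun a => ?_
    have hQa : ∀ j : Fin k, Measurable fun b => Q (i.succAbove j) a b := fun j =>
      (hQ _).comp measurable_prodMk_left
    have hprod : Measurable fun m : Fin k → 𝓜 => ∏ j, Q (i.succAbove j) a (m j) :=
      Finset.measurable_prod _ fun j _ => (hQa j).comp (measurable_pi_apply j)
    change ∫⁻ m : Fin k → 𝓜, P a * ∏ j, Q (i.succAbove j) a (m j) ∂(Measure.pi fun _ => κ) = _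
    rw [lintegral_const_mul _ hprod]
    congr 1
    rw [lintegral_prod_eq_prod_lintegral_of_indepFun Finset.univ
      (fun j (m : Fin k → 𝓜) => Q (i.succAbove j) a (m j))
      (iIndepFun_pi (X := fun j b => Q (i.succAbove j) a b) fun j => (hQa j).aemeasurable)
      fun j => (hQa j).comp (measurable_pi_apply j)]
    refine Finset.prod_congr rfl fun j _ => ?_
    exact (measurePreserving_eval (fun _ : Fin k => κ) j).lintegral_comp (hQa j)

lemma lintegral_lintegral_sum_markGain {rank : 𝓜 → ℝ} (hrank : Measurable rank)
    {Acc : Set (𝓜 × ℝ≥0)} (hAcc : MeasurableSet Acc) {X : Fin n → Ω → ℝ≥0}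
    (hX : ∀ i, Measurable (X i)) {μ : Measure Ω} [SFinite μ] (hind : iIndepFun X μ) (κ : Measure 𝓜)
    [IsProbabilityMeasure κ] :
    ∫⁻ m, ∫⁻ ω, ∑ i, markGain rank Acc m (fun j => X j ω) i ∂μ ∂(Measure.pi fun _ : Fin n => κ)
      = ∑ i, ∫⁻ a, (∫⁻ ω, markReward Acc a (X i ω) ∂μ)
          * ∏ j ∈ Finset.univ.erase i, ∫⁻ b, ∫⁻ ω, markPass rank Acc a b (X j ω) ∂μ ∂κ ∂κ := by
  have h1 : ∀ m : Fin n → 𝓜, ∫⁻ ω, ∑ i, markGain rank Acc m (fun j => X j ω) i ∂μ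
      = ∑ i, ∫⁻ ω, markGain rank Acc m (fun j => X j ω) i ∂μ := fun m =>
    lintegral_finsetSum _ fun i _ =>
      (measurable_markGain hrank hAcc hX i).comp measurable_prodMk_left
  simp_rw [h1]
  rw [lintegral_finsetSum _ fun i _ =>
    (measurable_markGain hrank hAcc hX i).lintegral_prod_right']
  refine Finset.sum_congr rfl fun i _ => ?_
  simp_rw [lintegral_markGain hrank hAcc hX hind]
  refine lintegral_pi_mul_prod_erase (P := fun a => ∫⁻ ω, markReward Acc a (X i ω) ∂μ)
    (Q := fun j a b => ∫⁻ ω, markPass rank Acc a b (X j ω) ∂μ) ?_ (fun j => ?_) i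
  · exact Measurable.lintegral_prod_right' (f := fun q : 𝓜 × Ω => markReward Acc q.1 (X i q.2))
      ((measurable_markReward hAcc).comp (measurable_fst.prodMk ((hX i).comp measurable_snd)))
  · exact Measurable.lintegral_prod_right'
      (f := fun q : (𝓜 × 𝓜) × Ω => markPass rank Acc q.1.1 q.1.2 (X j q.2))
      ((measurable_markPass hrank hAcc).comp ((measurable_fst.comp measurable_fst).prodMk
        ((measurable_snd.comp measurable_fst).prodMk ((hX j).comp measurable_snd))))

end Marks

/-! ### Randomized quantiles of the maximum -/

section Quantile

variable {n : ℕ}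

/-- The probability that independent variables with laws `ν j` all lie in `D`. -/
noncomputable def jointReal (ν : Fin n → Measure ℝ≥0) (D : Set ℝ≥0) : ℝ := ∏ j, (ν j).real D

/-- The `y`-quantile of the maximum of independent variables with laws `ν j`. -/
noncomputable def maxQuantile (ν : Fin n → Measure ℝ≥0) (y : ℝ) : ℝ≥0 :=
  open Classical in if y ∈ Set.Ioo (0 : ℝ) 1 then sInf {u | y ≤ jointReal ν (Set.Iic u)} else 0

/-- The closed (`true`) and the open (`false`) initial segment up to `v`, both containing `0`. -/
def initialSegment (v : ℝ≥0) (b : Bool) : Set ℝ≥0 :=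
  if b then Set.Iic v else insert 0 (Set.Iio v)

/-- The weight of the closed segment in the mixture of initial segments whose joint log-probability
is `log y` on average. -/
noncomputable def closedWeight (ν : Fin n → Measure ℝ≥0) (y : ℝ) : ℝ :=
  (Real.log y - Real.log (jointReal ν (initialSegment (maxQuantile ν y) false)))
    / (Real.log (jointReal ν (initialSegment (maxQuantile ν y) true))
      - Real.log (jointReal ν (initialSegment (maxQuantile ν y) false)))

/-- The weights of the closed and of the open segment. -/
noncomputable def segmentWeight (ν : Fin n → Measure ℝ≥0) (y : ℝ) (b : Bool) : ℝ :=
  if b then closedWeight ν y else 1 - closedWeight ν y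

lemma initialSegment_mono {v w : ℝ≥0} (h : v ≤ w) (b : Bool) :
    initialSegment v b ⊆ initialSegment w b := by
  cases b
  · exact Set.insert_subset_insert (Set.Iio_subset_Iio h)
  · exact Set.Iic_subset_Iic.2 h

lemma zero_mem_initialSegment (v : ℝ≥0) (b : Bool) : 0 ∈ initialSegment v b := by
  cases b <;> simp [initialSegment]

lemma measurableSet_initialSegment (v : ℝ≥0) (b : Bool) : MeasurableSet (initialSegment v b) := by
  cases b
  · exact measurableSet_Iio.insert 0
  · exact measurableSet_Iic

lemma initialSegment_subset_Iic (v : ℝ≥0) (b : Bool) : initialSegment v b ⊆ Set.Iic v := by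
  cases b
  · exact Set.insert_subset (zero_le : (0 : ℝ≥0) ≤ v) Set.Iio_subset_Iic_self
  · exact subset_rfl

lemma initialSegment_zero (b : Bool) : initialSegment 0 b = {0} := by
  cases b
  · ext x; simp [initialSegment]
  · ext x; simp [initialSegment]

variable {ν : Fin n → Measure ℝ≥0} [∀ j, IsProbabilityMeasure (ν j)]

omit [∀ j, IsProbabilityMeasure (ν j)] in
lemma jointReal_nonneg (D : Set ℝ≥0) : 0 ≤ jointReal ν D :=
  Finset.prod_nonneg fun _ _ => measureReal_nonneg

lemma jointReal_le_one (D : Set ℝ≥0) : jointReal ν D ≤ 1 :=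
  Finset.prod_le_one (fun _ _ => measureReal_nonneg) fun _ _ => measureReal_le_one

lemma jointReal_mono {D E : Set ℝ≥0} (h : D ⊆ E) : jointReal ν D ≤ jointReal ν E :=
  Finset.prod_le_prod (fun _ _ => measureReal_nonneg) fun _ _ => measureReal_mono h

lemma jointReal_pos (hν : ∀ j, 0 < (ν j).real {0}) {D : Set ℝ≥0} (hD : 0 ∈ D) :
    0 < jointReal ν D :=
  Finset.prod_pos fun j _ => (hν j).trans_le (measureReal_mono (Set.singleton_subset_iff.2 hD))

/-! ### One-sided continuity and the quantile inequalities. -/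

lemma tendsto_jointReal_iUnion {s : ℕ → Set ℝ≥0} (hs : Monotone s) :
    Filter.Tendsto (fun k => jointReal ν (s k)) Filter.atTop (nhds (jointReal ν (⋃ k, s k))) :=
  tendsto_finsetProd _ fun _ _ =>
    (ENNReal.tendsto_toReal (measure_ne_top _ _)).comp (tendsto_measure_iUnion_atTop hs)

lemma tendsto_jointReal_iInter {s : ℕ → Set ℝ≥0} (hs : Antitone s)
    (hm : ∀ k, MeasurableSet (s k)) :
    Filter.Tendsto (fun k => jointReal ν (s k)) Filter.atTop (nhds (jointReal ν (⋂ k, s k))) :=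
  tendsto_finsetProd _ fun _ _ =>
    (ENNReal.tendsto_toReal (measure_ne_top _ _)).comp (tendsto_measure_iInter_atTop
      (fun k => (hm k).nullMeasurableSet) hs ⟨0, measure_ne_top _ _⟩)

lemma exists_le_jointReal_Iic {y : ℝ} (hy : y < 1) : ∃ u, y ≤ jointReal ν (Set.Iic u) := by
  have h := tendsto_jointReal_iUnion (ν := ν) (s := fun k : ℕ => Set.Iic (k : ℝ≥0))
    fun a b hab => Set.Iic_subset_Iic.2 (Nat.cast_le.2 hab)
  have huniv : ⋃ k : ℕ, Set.Iic (k : ℝ≥0) = Set.univ :=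
    Set.eq_univ_of_forall fun x => Set.mem_iUnion.2 (exists_nat_ge x)
  rw [huniv] at h
  have h1 : jointReal ν Set.univ = 1 := by simp [jointReal]
  rw [h1] at h
  obtain ⟨k, hk⟩ := (h.eventually (lt_mem_nhds hy)).exists
  exact ⟨k, hk.le⟩

/-- The infimum defining the quantile is attained, by continuity of the joint probability along
decreasing segments. -/
lemma le_jointReal_Iic_maxQuantile {y : ℝ} (hy : y ∈ Set.Ioo (0 : ℝ) 1) :
    y ≤ jointReal ν (Set.Iic (maxQuantile ν y)) := by
  obtain ⟨u, hu, hlt, hlim⟩ := exists_seq_strictAnti_tendsto (maxQuantile ν y)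
  have h := tendsto_jointReal_iInter (ν := ν) (s := fun k => Set.Iic (u k))
    (fun a b hab => Set.Iic_subset_Iic.2 (hu.antitone hab)) fun _ => measurableSet_Iic
  have hInter : ⋂ k, Set.Iic (u k) = Set.Iic (maxQuantile ν y) := by
    ext x
    simp only [Set.mem_iInter, Set.mem_Iic]
    exact ⟨fun hx => ge_of_tendsto' hlim hx, fun hx k => hx.trans (hlt k).le⟩
  rw [hInter] at h
  refine ge_of_tendsto' h fun k => ?_
  have hk := hlt k
  rw [maxQuantile, if_pos hy] at hk
  obtain ⟨w, hw, hwk⟩ := (csInf_lt_iff (OrderBot.bddBelow _)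
    (exists_le_jointReal_Iic hy.2)).1 hk
  exact le_trans hw (jointReal_mono (Set.Iic_subset_Iic.2 hwk.le))

lemma maxQuantile_le_iff {y : ℝ} (hy : y ∈ Set.Ioo (0 : ℝ) 1) {u : ℝ≥0} :
    maxQuantile ν y ≤ u ↔ y ≤ jointReal ν (Set.Iic u) := by
  refine ⟨fun h => (le_jointReal_Iic_maxQuantile hy).trans
    (jointReal_mono (Set.Iic_subset_Iic.2 h)), fun h => ?_⟩
  rw [maxQuantile, if_pos hy]
  exact csInf_le (OrderBot.bddBelow _) h

/-- Continuity from the left. Positivity of the quantile matters: the point `0` inserted in the open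
segment then already lies in `Set.Iio`. -/
lemma jointReal_open_le {y : ℝ} (hy : y ∈ Set.Ioo (0 : ℝ) 1) (hv : 0 < maxQuantile ν y) :
    jointReal ν (initialSegment (maxQuantile ν y) false) ≤ y := by
  obtain ⟨u, hu, hlt, hlim⟩ := exists_seq_strictMono_tendsto' hv
  have h := tendsto_jointReal_iUnion (ν := ν) (s := fun k => Set.Iic (u k))
    fun a b hab => Set.Iic_subset_Iic.2 (hu.monotone hab)
  rw [iUnion_Iic_eq_Iio_of_lt_of_tendsto (fun k => (hlt k).2) hlim] at h
  have hins : initialSegment (maxQuantile ν y) false = Set.Iio (maxQuantile ν y) := by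
    simpa [initialSegment] using hv
  rw [hins]
  exact le_of_tendsto' h fun k => (not_le.1 (mt (maxQuantile_le_iff hy).2 (hlt k).2.not_ge)).le

/-! ### Measurability in the level. -/

lemma measurable_maxQuantile : Measurable (maxQuantile ν) := by
  refine measurable_of_Iic fun u => ?_
  have : maxQuantile ν ⁻¹' Set.Iic u
      = (Set.Ioo 0 1 ∩ Set.Iic (jointReal ν (Set.Iic u))) ∪ (Set.Ioo 0 1)ᶜ := by
    ext y
    by_cases hy : y ∈ Set.Ioo (0 : ℝ) 1
    · rw [Set.mem_preimage, Set.mem_Iic, maxQuantile_le_iff hy]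
      simp [hy.1, hy.2]
    · rw [Set.mem_preimage, maxQuantile, if_neg hy]
      simp only [Set.mem_Iic, zero_le, Set.mem_union, Set.mem_compl_iff, hy, not_false_iff, or_true]
  rw [this]
  exact (measurableSet_Ioo.inter measurableSet_Iic).union measurableSet_Ioo.compl

lemma measurable_measure_initialSegment (j : Fin n) (b : Bool) :
    Measurable fun y => ν j (initialSegment (maxQuantile ν y) b) := by
  have h : Monotone fun v => ν j (initialSegment v b) := fun v w hvw =>
    measure_mono (initialSegment_mono hvw b)
  exact h.measurable.comp measurable_maxQuantile

lemma measurable_jointReal_initialSegment (b : Bool) :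
    Measurable fun y => jointReal ν (initialSegment (maxQuantile ν y) b) :=
  Finset.measurable_prod _ fun j _ => (measurable_measure_initialSegment j b).ennreal_toReal

lemma measurable_closedWeight : Measurable (closedWeight ν) :=
  (Real.measurable_log.sub (measurable_jointReal_initialSegment false).log).div
    ((measurable_jointReal_initialSegment true).log.sub
      (measurable_jointReal_initialSegment false).log)

lemma measurable_segmentWeight (b : Bool) : Measurable fun y => segmentWeight ν y b := by
  cases b
  · exact measurable_closedWeight.const_sub 1
  · exact measurable_closedWeight

/-! ### The mixture of the closed and the open segment. -/

omit [∀ j, IsProbabilityMeasure (ν j)] in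
lemma closedWeight_of_maxQuantile_eq_zero {y : ℝ} (hv : maxQuantile ν y = 0) :
    closedWeight ν y = 0 := by
  simp [closedWeight, hv, initialSegment_zero]

lemma log_open_le_log (hν : ∀ j, 0 < (ν j).real {0}) {y : ℝ} (hy : y ∈ Set.Ioo (0 : ℝ) 1)
    (hv : 0 < maxQuantile ν y) :
    Real.log (jointReal ν (initialSegment (maxQuantile ν y) false)) ≤ Real.log y :=
  Real.log_le_log (jointReal_pos hν (zero_mem_initialSegment _ _)) (jointReal_open_le hy hv)

lemma log_le_log_closed {y : ℝ} (hy : y ∈ Set.Ioo (0 : ℝ) 1) :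
    Real.log y ≤ Real.log (jointReal ν (initialSegment (maxQuantile ν y) true)) :=
  Real.log_le_log hy.1 (le_jointReal_Iic_maxQuantile hy)

lemma closedWeight_mem_Icc (hν : ∀ j, 0 < (ν j).real {0}) {y : ℝ} (hy : y ∈ Set.Ioo (0 : ℝ) 1) :
    closedWeight ν y ∈ Set.Icc (0 : ℝ) 1 := by
  rcases eq_zero_or_pos (maxQuantile ν y) with hv | hv
  · simp [closedWeight_of_maxQuantile_eq_zero hv]
  · have h1 := log_open_le_log hν hy hv
    have h2 := log_le_log_closed (ν := ν) hy
    exact ⟨div_nonneg (by linarith) (by linarith), div_le_one_of_le₀ (by linarith) (by linarith)⟩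

lemma segmentWeight_nonneg (hν : ∀ j, 0 < (ν j).real {0}) {y : ℝ} (hy : y ∈ Set.Ioo (0 : ℝ) 1)
    (b : Bool) : 0 ≤ segmentWeight ν y b := by
  have := closedWeight_mem_Icc hν hy
  cases b
  · simpa [segmentWeight] using this.2
  · simpa [segmentWeight] using this.1

omit [∀ j, IsProbabilityMeasure (ν j)] in
lemma sum_segmentWeight (y : ℝ) : ∑ b, segmentWeight ν y b = 1 := by
  simp [segmentWeight]

lemma sum_segmentWeight_mul_log_of_pos (hν : ∀ j, 0 < (ν j).real {0}) {y : ℝ}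
    (hy : y ∈ Set.Ioo (0 : ℝ) 1) (hv : 0 < maxQuantile ν y) :
    ∑ b, segmentWeight ν y b * Real.log (jointReal ν (initialSegment (maxQuantile ν y) b))
      = Real.log y := by
  have h1 := log_open_le_log hν hy hv
  have h2 := log_le_log_closed (ν := ν) hy
  simp only [Fintype.sum_bool, segmentWeight, if_true, Bool.false_eq_true, if_false]
  -- If the two logarithms agree, both equal `log y`, squeezed between them, and the value `0` that
  -- division by zero gives the weight is harmless.
  rcases eq_or_ne (Real.log (jointReal ν (initialSegment (maxQuantile ν y) true))
      - Real.log (jointReal ν (initialSegment (maxQuantile ν y) false))) 0 with h0 | h0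
  · have : closedWeight ν y = 0 := by rw [closedWeight, h0, div_zero]
    rw [this]
    linarith
  · have : closedWeight ν y * (Real.log (jointReal ν (initialSegment (maxQuantile ν y) true))
      - Real.log (jointReal ν (initialSegment (maxQuantile ν y) false)))
      = Real.log y - Real.log (jointReal ν (initialSegment (maxQuantile ν y) false)) :=
      div_mul_cancel₀ _ h0
    linarith

/-- At quantile `0` both segments are `{0}`, whose joint probability may exceed `y`. Only an
inequality survives, in the direction that favours reachability. -/
lemma log_le_sum_segmentWeight_mul_log (hν : ∀ j, 0 < (ν j).real {0}) {y : ℝ}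
    (hy : y ∈ Set.Ioo (0 : ℝ) 1) :
    Real.log y ≤
      ∑ b, segmentWeight ν y b * Real.log (jointReal ν (initialSegment (maxQuantile ν y) b)) := by
  rcases eq_zero_or_pos (maxQuantile ν y) with hv | hv
  · have h2 := log_le_log_closed (ν := ν) hy
    rw [hv, initialSegment_zero] at h2
    simp_rw [hv, initialSegment_zero, ← Finset.sum_mul, sum_segmentWeight]
    simpa using h2
  · exact (sum_segmentWeight_mul_log_of_pos hν hy hv).ge

/-- The complement of the union consists of the accepted values above `u`. Either `u` is at least
the quantile and swallows both segments, or `u` is positioned strictly below it and the mixture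
gives exactly `log y`; no loss occurs at quantile `0`. -/
lemma neg_log_max_le_sum_segmentWeight (hν : ∀ j, 0 < (ν j).real {0}) {y : ℝ}
    (hy : y ∈ Set.Ioo (0 : ℝ) 1) (u : ℝ≥0) :
    -Real.log (max y (jointReal ν (Set.Iic u))) ≤
      ∑ b, segmentWeight ν y b
        * -Real.log (jointReal ν (initialSegment (maxQuantile ν y) b ∪ Set.Iic u)) := by
  rcases le_or_gt (maxQuantile ν y) u with hu | hu
  · have he : ∀ b, initialSegment (maxQuantile ν y) b ∪ Set.Iic u = Set.Iic u := fun b =>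
      Set.union_eq_self_of_subset_left
        ((initialSegment_subset_Iic _ b).trans (Set.Iic_subset_Iic.2 hu))
    simp_rw [he, ← Finset.sum_mul, sum_segmentWeight]
    rw [max_eq_right ((maxQuantile_le_iff hy).1 hu), one_mul]
  · have he : ∀ b, initialSegment (maxQuantile ν y) b ∪ Set.Iic u
        = initialSegment (maxQuantile ν y) b := by
      intro b
      refine Set.union_eq_self_of_subset_right fun x hx => ?_
      have hx' : x < maxQuantile ν y := lt_of_le_of_lt hx hu
      cases b
      · exact Or.inr hx'
      · exact hx'.le
    have hlt : jointReal ν (Set.Iic u) < y := not_le.1 (mt (maxQuantile_le_iff hy).2 hu.not_ge)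
    simp_rw [he, mul_neg, Finset.sum_neg_distrib]
    rw [max_eq_left hlt.le, sum_segmentWeight_mul_log_of_pos hν hy ((zero_le).trans_lt hu)]

end Quantile

/-! ### The marks -/

section KertzMarks

variable {n : ℕ} (ν : Fin n → Measure ℝ≥0)

/-- The law of a mark: a level in `(0, 1)` with density `1 / kertzRate`, and the choice of the
closed or of the open segment below the quantile of that level. -/
noncomputable def markLaw : Measure (ℝ × Bool) :=
  ((volume.restrict (Set.Ioo (0 : ℝ) 1)).prod Measure.count).withDensity
    fun q => ENNReal.ofReal (segmentWeight ν q.1 q.2 / kertzRate q.1)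

/-- The pairs of a mark and a value that are accepted. -/
def markAccept : Set ((ℝ × Bool) × ℝ≥0) :=
  {q | q.2 ∉ initialSegment (maxQuantile ν q.1.1) q.1.2}

/-- Boxes of higher level arrive earlier. -/
def markRank (q : ℝ × Bool) : ℝ := -q.1

lemma measurable_markRank : Measurable markRank := measurable_fst.neg

variable {ν} [∀ j, IsProbabilityMeasure (ν j)]

lemma measurableSet_markAccept : MeasurableSet (markAccept ν) := by
  have hq : Measurable fun q : (ℝ × Bool) × ℝ≥0 => maxQuantile ν q.1.1 :=
    measurable_maxQuantile.comp (measurable_fst.comp measurable_fst)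
  have hb : MeasurableSet {q : (ℝ × Bool) × ℝ≥0 | q.1.2 = true} :=
    (measurable_snd.comp measurable_fst) (measurableSet_singleton true)
  have : markAccept ν = ({q | q.1.2 = true} ∩ {q | maxQuantile ν q.1.1 < q.2}) ∪
      ({q | q.1.2 = true}ᶜ ∩ ({q | q.2 = 0}ᶜ ∩ {q | maxQuantile ν q.1.1 ≤ q.2})) := by
    ext ⟨⟨y, b⟩, x⟩
    cases b <;> simp [markAccept, initialSegment]
  rw [this]
  refine (hb.inter (measurableSet_lt hq measurable_snd)).union (hb.compl.inter
    ((measurable_snd (measurableSet_singleton (0 : ℝ≥0))).compl.inter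
      (measurableSet_le hq measurable_snd)))

lemma measurable_markDensity :
    Measurable fun q : ℝ × Bool => ENNReal.ofReal (segmentWeight ν q.1 q.2 / kertzRate q.1) := by
  refine measurable_from_prod_countable_left fun b => ?_
  exact ((measurable_segmentWeight b).div continuous_kertzRate.measurable).ennreal_ofReal

lemma lintegral_markLaw {G : ℝ × Bool → ℝ≥0∞} (hG : Measurable G) :
    ∫⁻ q, G q ∂(markLaw ν) = ∫⁻ y in Set.Ioo (0 : ℝ) 1,
      ∑ b, ENNReal.ofReal (segmentWeight ν y b / kertzRate y) * G (y, b) := by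
  rw [markLaw, lintegral_withDensity_eq_lintegral_mul _ measurable_markDensity hG,
    lintegral_prod _ (measurable_markDensity.mul hG).aemeasurable]
  refine lintegral_congr fun y => ?_
  rw [lintegral_count, tsum_fintype]
  rfl

omit [∀ j, IsProbabilityMeasure (ν j)] in
lemma ae_markLaw_mem_Ioo : ∀ᵐ q ∂(markLaw ν), q.1 ∈ Set.Ioo (0 : ℝ) 1 :=
  (withDensity_absolutelyContinuous _ _).ae_le
    (Measure.quasiMeasurePreserving_fst.ae (ae_restrict_mem measurableSet_Ioo))

lemma isProbabilityMeasure_markLaw (hν : ∀ j, 0 < (ν j).real {0}) :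
    IsProbabilityMeasure (markLaw ν) := by
  constructor
  rw [← lintegral_one, lintegral_markLaw measurable_const]
  refine Eq.trans (setLIntegral_congr_fun measurableSet_Ioo fun y hy => ?_) lintegral_inv_kertzRate
  have h := kertzRate_pos hy.1.le hy.2.le
  simp only [mul_one]
  rw [← ENNReal.ofReal_sum_of_nonneg fun b _ => div_nonneg (segmentWeight_nonneg hν hy b) h.le,
    ← Finset.sum_div, sum_segmentWeight, one_div]

/-! ### The probability of reaching a level. -/

/-- The probability that a variable of law `ν j` and mark `q` leaves level `y` reachable. -/
noncomputable def passProb (ν : Fin n → Measure ℝ≥0) (y : ℝ) (j : Fin n) (q : ℝ × Bool) : ℝ :=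
  if y ≤ q.1 then (ν j).real (initialSegment (maxQuantile ν q.1) q.2) else 1

lemma passProb_le_one (y : ℝ) (j : Fin n) (q : ℝ × Bool) : passProb ν y j q ≤ 1 := by
  unfold passProb
  split_ifs
  · exact measureReal_le_one
  · exact le_rfl

lemma real_zero_le_passProb (y : ℝ) (j : Fin n) (q : ℝ × Bool) :
    (ν j).real {0} ≤ passProb ν y j q := by
  unfold passProb
  split_ifs
  · exact measureReal_mono (Set.singleton_subset_iff.2 (zero_mem_initialSegment _ _))
  · exact measureReal_le_one

lemma measurable_passProb (y : ℝ) (j : Fin n) : Measurable (passProb ν y j) := by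
  refine measurable_from_prod_countable_left fun b => ?_
  exact Measurable.ite measurableSet_Ici (measurable_measure_initialSegment j b).ennreal_toReal
    measurable_const

lemma lintegral_markPass (a q : ℝ × Bool) (j : Fin n) :
    ∫⁻ x, markPass markRank (markAccept ν) a q x ∂(ν j) = ENNReal.ofReal (passProb ν a.1 j q) := by
  by_cases h : a.1 ≤ q.1
  · have e : ∀ x, markPass markRank (markAccept ν) a q x
        = (initialSegment (maxQuantile ν q.1) q.2).indicator 1 x := by
      intro x
      by_cases hx : x ∈ initialSegment (maxQuantile ν q.1) q.2 <;>
        simp [markPass, markRank, h, markAccept, hx]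
    simp_rw [e]
    rw [lintegral_indicator_one (measurableSet_initialSegment _ _), passProb, if_pos h,
      ofReal_measureReal]
  · simp [markPass, markRank, h, passProb]

/-- Logarithms combine the boxes into the joint probability, the only quantity that the quantile
controls. -/
lemma sum_log_passProb (hν : ∀ j, 0 < (ν j).real {0}) (y : ℝ) (q : ℝ × Bool) :
    ∑ j, Real.log (passProb ν y j q)
      = if y ≤ q.1 then Real.log (jointReal ν (initialSegment (maxQuantile ν q.1) q.2)) else 0 := by
  unfold passProb
  split_ifs
  · rw [jointReal, Real.log_prod fun j _ => ((hν j).trans_le (measureReal_mono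
      (Set.singleton_subset_iff.2 (zero_mem_initialSegment _ _)))).ne']
  · simp

/-- Only marks of level `z ≥ y` can block; at such a `z` the mean logarithm over the two segments is
at least `log z`, and the density is `1 / kertzRate z`. -/
lemma integral_log_div_le_integral_sum_log_passProb (hν : ∀ j, 0 < (ν j).real {0}) {y : ℝ}
    (hy : y ∈ Set.Ioo (0 : ℝ) 1) :
    ∫ z in y..1, Real.log z / kertzRate z
      ≤ ∫ q, ∑ j, Real.log (passProb ν y j q) ∂(markLaw ν) := by
  have hnonneg : ∀ q, 0 ≤ -∑ j, Real.log (passProb ν y j q) := fun q =>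
    neg_nonneg.2 (Finset.sum_nonpos fun j _ => Real.log_nonpos
      (measureReal_nonneg.trans (real_zero_le_passProb y j q)) (passProb_le_one y j q))
  have hmeas : Measurable fun q => -∑ j, Real.log (passProb ν y j q) :=
    (Finset.measurable_sum _ fun j _ => (measurable_passProb y j).log).neg
  have hq0 : ∀ z ∈ Set.Icc y 1, 0 ≤ -(Real.log z / kertzRate z) := fun z hz => by
    rw [← neg_div]
    exact div_nonneg (neg_nonneg.2 (Real.log_nonpos (hy.1.le.trans hz.1) hz.2))
      (kertzRate_pos (hy.1.le.trans hz.1) hz.2).le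
  have hcont : ContinuousOn (fun z => -(Real.log z / kertzRate z)) (Set.Icc y 1) := by
    refine (ContinuousOn.div ?_ continuous_kertzRate.continuousOn fun z hz =>
      (kertzRate_pos (hy.1.le.trans hz.1) hz.2).ne').neg
    exact Real.continuousOn_log.mono fun z hz => (hy.1.trans_le hz.1).ne'
  -- Both integrands are negated to be nonnegative, so that the comparison takes place in `ℝ≥0∞`.
  have hle : ∫⁻ q, ENNReal.ofReal (-∑ j, Real.log (passProb ν y j q)) ∂(markLaw ν)
      ≤ ENNReal.ofReal (∫ z in y..1, -(Real.log z / kertzRate z)) := by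
    rw [lintegral_markLaw hmeas.ennreal_ofReal, intervalIntegral.integral_of_le hy.2.le,
      ofReal_integral_eq_lintegral_ofReal
        (hcont.integrableOn_Icc.mono_set Set.Ioc_subset_Icc_self)
        ((ae_restrict_mem measurableSet_Ioc).mono fun z hz => hq0 z (Set.Ioc_subset_Icc_self hz)),
      setLIntegral_congr (Ioc_ae_eq_Icc (μ := volume) (a := y) (b := 1)),
      ← lintegral_indicator measurableSet_Icc]
    refine (setLIntegral_mono' measurableSet_Ioo fun z hz => ?_).trans
      (setLIntegral_le_lintegral (Set.Ioo 0 1) _)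
    have hr := kertzRate_pos hz.1.le hz.2.le
    by_cases hyz : y ≤ z
    · rw [Set.indicator_of_mem (show z ∈ Set.Icc y 1 from ⟨hyz, hz.2.le⟩)]
      have h1 := log_le_sum_segmentWeight_mul_log hν hz
      simp_rw [sum_log_passProb hν, if_pos hyz]
      simp_rw [← ENNReal.ofReal_mul (div_nonneg (segmentWeight_nonneg hν hz _) hr.le)]
      have hlog : ∀ b, 0 ≤ -Real.log (jointReal ν (initialSegment (maxQuantile ν z) b)) :=
        fun b => neg_nonneg.2 (Real.log_nonpos (jointReal_nonneg _) (jointReal_le_one _))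
      rw [← ENNReal.ofReal_sum_of_nonneg fun b _ =>
        mul_nonneg (div_nonneg (segmentWeight_nonneg hν hz b) hr.le) (hlog b)]
      refine ENNReal.ofReal_le_ofReal ?_
      have e : ∑ b, segmentWeight ν z b / kertzRate z
            * -Real.log (jointReal ν (initialSegment (maxQuantile ν z) b))
          = -(∑ b, segmentWeight ν z b
            * Real.log (jointReal ν (initialSegment (maxQuantile ν z) b))) / kertzRate z := by
        rw [neg_div, Finset.sum_div, ← Finset.sum_neg_distrib]
        exact Finset.sum_congr rfl fun b _ => by ring
      rw [e, ← neg_div]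
      exact div_le_div_of_nonneg_right (neg_le_neg h1) hr.le
    · simp [sum_log_passProb hν, hyz]
  have hkey := ENNReal.toReal_mono ENNReal.ofReal_ne_top hle
  rw [← integral_eq_lintegral_of_nonneg_ae (Filter.Eventually.of_forall hnonneg)
    hmeas.aestronglyMeasurable, ENNReal.toReal_ofReal, integral_neg,
    intervalIntegral.integral_neg] at hkey
  · linarith
  · exact intervalIntegral.integral_nonneg hy.2.le hq0

/-- A box of level `y` is still reachable with probability at least `β * kertzRate y`. -/
lemma ofReal_mul_kertzRate_le_prod_lintegral_passProb (hν : ∀ j, 0 < (ν j).real {0}) {y : ℝ}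
    (hy : y ∈ Set.Ioo (0 : ℝ) 1) (s : Finset (Fin n)) :
    ENNReal.ofReal (kertzConstant * kertzRate y)
      ≤ ∏ j ∈ s, ∫⁻ q, ENNReal.ofReal (passProb ν y j q) ∂(markLaw ν) := by
  have := isProbabilityMeasure_markLaw hν
  have hpos : ∀ j q, 0 < passProb ν y j q := fun j q => (hν j).trans_le (real_zero_le_passProb y j q)
  have hint : ∀ j, Integrable (passProb ν y j) (markLaw ν) := fun j =>
    Integrable.of_bound (measurable_passProb y j).aestronglyMeasurable 1
      (Filter.Eventually.of_forall fun q => by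
        rw [Real.norm_of_nonneg (hpos j q).le]; exact passProb_le_one y j q)
  -- Every segment contains `0`, so the positive mass at `0` bounds the logarithms from below.
  have hintlog : ∀ j, Integrable (fun q => Real.log (passProb ν y j q)) (markLaw ν) := fun j =>
    Integrable.of_bound (measurable_passProb y j).log.aestronglyMeasurable
      (-Real.log ((ν j).real {0})) (Filter.Eventually.of_forall fun q => by
        rw [Real.norm_of_nonpos (Real.log_nonpos (hpos j q).le (passProb_le_one y j q))]
        exact neg_le_neg (Real.log_le_log (hν j) (real_zero_le_passProb y j q)))
  -- Jensen's inequality for `exp`, one box at a time.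
  have hjensen : ∀ j, ENNReal.ofReal (Real.exp (∫ q, Real.log (passProb ν y j q) ∂(markLaw ν)))
      ≤ ∫⁻ q, ENNReal.ofReal (passProb ν y j q) ∂(markLaw ν) := by
    intro j
    rw [← ofReal_integral_eq_lintegral_ofReal (hint j)
      (Filter.Eventually.of_forall fun q => (hpos j q).le)]
    refine ENNReal.ofReal_le_ofReal ?_
    have he : Real.exp ∘ (fun q => Real.log (passProb ν y j q)) = passProb ν y j :=
      funext fun q => Real.exp_log (hpos j q)
    have h := convexOn_exp.map_integral_le Real.continuous_exp.continuousOn isClosed_univ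
      (Filter.Eventually.of_forall fun _ => Set.mem_univ _) (hintlog j) (by rw [he]; exact hint j)
    refine h.trans_eq (integral_congr_ae (Filter.Eventually.of_forall fun q => ?_))
    exact Real.exp_log (hpos j q)
  calc ENNReal.ofReal (kertzConstant * kertzRate y)
      ≤ ENNReal.ofReal (Real.exp (∑ j, ∫ q, Real.log (passProb ν y j q) ∂(markLaw ν))) := by
        rw [← exp_integral_log_div_kertzRate hy.1 hy.2.le,
          ← integral_finsetSum _ fun j _ => hintlog j]
        exact ENNReal.ofReal_le_ofReal
          (Real.exp_le_exp.2 (integral_log_div_le_integral_sum_log_passProb hν hy))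
    _ = ∏ j, ENNReal.ofReal (Real.exp (∫ q, Real.log (passProb ν y j q) ∂(markLaw ν))) := by
        rw [Real.exp_sum, ENNReal.ofReal_prod_of_nonneg fun j _ => (Real.exp_pos _).le]
    _ ≤ ∏ j, ∫⁻ q, ENNReal.ofReal (passProb ν y j q) ∂(markLaw ν) :=
        Finset.prod_le_prod' fun j _ => hjensen j
    -- Dropping factors that are at most one; in the application the box itself is dropped.
    _ ≤ ∏ j ∈ s, ∫⁻ q, ENNReal.ofReal (passProb ν y j q) ∂(markLaw ν) := by
        refine Finset.prod_le_prod_of_subset_of_le_one' (Finset.subset_univ s) fun j _ _ => ?_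
        calc _ ≤ ∫⁻ _, 1 ∂(markLaw ν) := lintegral_mono fun q =>
              ENNReal.ofReal_le_one.2 (passProb_le_one y j q)
          _ = 1 := by simp

/-! ### The reward above a level -/

/-- From `log q ≥ 1 - q⁻¹` one gets `q * (-log q) ≤ 1 - q`, and `q` is at least `1 - ε`. -/
lemma one_sub_mul_neg_log_le {ε q : ℝ} (hq : 0 < q) (hq1 : q ≤ 1) (hε : 1 - ε ≤ q) :
    (1 - ε) * -Real.log q ≤ 1 - q := by
  have h1 := Real.one_sub_inv_le_log_of_pos hq
  have h2 : 0 ≤ -Real.log q := neg_nonneg.2 (Real.log_nonpos hq.le hq1)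
  have h3 : q * q⁻¹ = 1 := mul_inv_cancel₀ hq.ne'
  nlinarith

/-- The only place where smallness is paid for with a factor `1 - ε`: since `0 ∈ D`, each box lies
in `D` with probability at least `1 - ε`, so its logarithm can be linearized. -/
lemma ofReal_neg_log_jointReal_le_sum {ε : ℝ} (hε : ε < 1) (hν : ∀ j, 1 - ε ≤ (ν j).real {0})
    {D : Set ℝ≥0} (hD : MeasurableSet D) (h0 : 0 ∈ D) :
    ENNReal.ofReal ((1 - ε) * -Real.log (jointReal ν D)) ≤ ∑ j, ν j Dᶜ := by
  have hle : ∀ j, 1 - ε ≤ (ν j).real D := fun j =>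
    (hν j).trans (measureReal_mono (Set.singleton_subset_iff.2 h0))
  have hpos : ∀ j, 0 < (ν j).real D := fun j => lt_of_lt_of_le (by linarith) (hle j)
  have hc : ∀ j, ν j Dᶜ = ENNReal.ofReal (1 - (ν j).real D) := fun j => by
    rw [← probReal_compl_eq_one_sub hD, ofReal_measureReal]
  simp_rw [hc]
  rw [← ENNReal.ofReal_sum_of_nonneg fun j _ => sub_nonneg.2 measureReal_le_one, jointReal,
    Real.log_prod fun j _ => (hpos j).ne', ← Finset.sum_neg_distrib, Finset.mul_sum]
  exact ENNReal.ofReal_le_ofReal (Finset.sum_le_sum fun j _ =>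
    one_sub_mul_neg_log_le (hpos j) measureReal_le_one (hle j))

/-- The left side is `1 - ε` times the tail of the maximum at `u`; the right side is the expected
number of accepted values above `u`, for boxes all at the same level and segment, averaged with
uniform weight over the level. -/
lemma ofReal_one_sub_jointReal_le {ε : ℝ} (hε : ε < 1) (hν : ∀ j, 1 - ε ≤ (ν j).real {0})
    (u : ℝ≥0) :
    ENNReal.ofReal ((1 - ε) * (1 - jointReal ν (Set.Iic u)))
      ≤ ∫⁻ y in Set.Ioo (0 : ℝ) 1, ∑ b, ENNReal.ofReal (segmentWeight ν y b)
          * ∑ i, ν i (initialSegment (maxQuantile ν y) b ∪ Set.Iic u)ᶜ := by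
  have hν' : ∀ j, 0 < (ν j).real {0} := fun j => lt_of_lt_of_le (by linarith) (hν j)
  have hε' : 0 ≤ 1 - ε := by linarith
  have hF : 0 < jointReal ν (Set.Iic u) := jointReal_pos hν' (zero_le : (0 : ℝ≥0) ≤ u)
  rw [ENNReal.ofReal_mul hε', ← lintegral_neg_log_max hF (jointReal_le_one _),
    ← lintegral_const_mul' _ _ ENNReal.ofReal_ne_top]
  refine setLIntegral_mono' measurableSet_Ioo fun y hy => ?_
  rw [← ENNReal.ofReal_mul hε']
  have hlog : ∀ b, 0 ≤ -Real.log (jointReal ν (initialSegment (maxQuantile ν y) b ∪ Set.Iic u)) :=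
    fun b => neg_nonneg.2 (Real.log_nonpos (jointReal_nonneg _) (jointReal_le_one _))
  calc _ ≤ ENNReal.ofReal (∑ b, segmentWeight ν y b * ((1 - ε)
        * -Real.log (jointReal ν (initialSegment (maxQuantile ν y) b ∪ Set.Iic u)))) := by
        refine ENNReal.ofReal_le_ofReal ?_
        refine (mul_le_mul_of_nonneg_left
          (neg_log_max_le_sum_segmentWeight hν' hy u) hε').trans_eq ?_
        rw [Finset.mul_sum]
        exact Finset.sum_congr rfl fun b _ => by ring
    _ ≤ _ := by
        rw [ENNReal.ofReal_sum_of_nonneg fun b _ =>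
          mul_nonneg (segmentWeight_nonneg hν' hy b) (mul_nonneg hε' (hlog b))]
        refine Finset.sum_le_sum fun b _ => ?_
        rw [ENNReal.ofReal_mul (segmentWeight_nonneg hν' hy b)]
        gcongr
        exact ofReal_neg_log_jointReal_le_sum hε hν
          ((measurableSet_initialSegment _ _).union measurableSet_Iic)
          (Or.inl (zero_mem_initialSegment _ _))

-- Layer-cake formula for the value restricted to the accepted set.
omit [∀ j, IsProbabilityMeasure (ν j)] in
lemma lintegral_markReward (q : ℝ × Bool) (i : Fin n) :
    ∫⁻ x, markReward (markAccept ν) q x ∂(ν i)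
      = ∫⁻ u in Set.Ioi (0 : ℝ),
          ν i (initialSegment (maxQuantile ν q.1) q.2 ∪ Set.Iic u.toNNReal)ᶜ := by
  classical
  have hm : Measurable fun x : ℝ≥0 => ((initialSegment (maxQuantile ν q.1) q.2)ᶜ).indicator
      (fun x : ℝ≥0 => (x : ℝ)) x :=
    measurable_coe_nnreal_real.indicator (measurableSet_initialSegment _ _).compl
  have h := lintegral_eq_lintegral_meas_lt (ν i) (f := fun x : ℝ≥0 =>
      ((initialSegment (maxQuantile ν q.1) q.2)ᶜ).indicator (fun x : ℝ≥0 => (x : ℝ)) x)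
    (Filter.Eventually.of_forall fun x => Set.indicator_nonneg (fun x _ => x.2) x) hm.aemeasurable
  refine Eq.trans (lintegral_congr fun x => ?_) (h.trans
    (setLIntegral_congr_fun measurableSet_Ioi fun u hu => ?_))
  · by_cases hx : x ∈ initialSegment (maxQuantile ν q.1) q.2 <;> simp [markReward, markAccept, hx]
  · congr 1
    ext x
    by_cases hx : x ∈ initialSegment (maxQuantile ν q.1) q.2
    · simpa [hx] using (Set.mem_Ioi.1 hu).le
    · simp [hx, Real.toNNReal_lt_iff_lt_coe (Set.mem_Ioi.1 hu).le]

end KertzMarks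

/-! ### The main estimate -/

section Main

variable {n : ℕ}

variable {ν : Fin n → Measure ℝ≥0} [∀ j, IsProbabilityMeasure (ν j)]

lemma measurable_measure_compl_initialSegment_union (b : Bool) (i : Fin n) :
    Measurable fun q : ℝ × ℝ =>
      ν i (initialSegment (maxQuantile ν q.2) b ∪ Set.Iic q.1.toNNReal)ᶜ := by
  have hlt : MeasurableSet {r : (ℝ × ℝ) × ℝ≥0 | r.1.1.toNNReal < r.2} :=
    measurableSet_lt (measurable_real_toNNReal.comp (measurable_fst.comp measurable_fst))
      measurable_snd
  have hS : MeasurableSet {r : (ℝ × ℝ) × ℝ≥0 |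
      ((r.1.2, b), r.2) ∈ markAccept ν ∧ r.1.1.toNNReal < r.2} :=
    MeasurableSet.inter
      ((((measurable_snd.comp measurable_fst).prodMk measurable_const).prodMk measurable_snd)
        measurableSet_markAccept) hlt
  have he : (fun q : ℝ × ℝ =>
      ν i (initialSegment (maxQuantile ν q.2) b ∪ Set.Iic q.1.toNNReal)ᶜ)
      = fun q => ν i (Prod.mk q ⁻¹' {r : (ℝ × ℝ) × ℝ≥0 |
        ((r.1.2, b), r.2) ∈ markAccept ν ∧ r.1.1.toNNReal < r.2}) := by
    funext q
    congr 1
    ext x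
    simp [markAccept]
  rw [he]
  exact measurable_measure_prodMk_left hS

lemma lintegral_lintegral_sum_mul_sum {α β ι ι' : Type*} [Fintype ι] [Fintype ι']
    [MeasurableSpace α] [MeasurableSpace β] {μ : Measure α} {ρ : Measure β} [SFinite μ] [SFinite ρ]
    {w : ι → β → ℝ≥0∞} {V : ι → ι' → α → β → ℝ≥0∞} (hw : ∀ b, Measurable (w b))
    (hV : ∀ b i, Measurable (Function.uncurry (V b i))) :
    ∫⁻ u, ∫⁻ y, ∑ b, w b y * ∑ i, V b i u y ∂ρ ∂μ
      = ∫⁻ y, ∑ b, w b y * ∑ i, ∫⁻ u, V b i u y ∂μ ∂ρ := by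
  have hsum : Measurable (Function.uncurry fun u y => ∑ b, w b y * ∑ i, V b i u y) := by
    refine Finset.measurable_fun_sum _ fun b _ => Measurable.mul ?_ ?_
    · exact (hw b).comp measurable_snd
    · exact Finset.measurable_fun_sum _ fun i _ => hV b i
  rw [lintegral_lintegral_swap hsum.aemeasurable]
  refine lintegral_congr fun y => ?_
  have hsec : ∀ b i, Measurable fun u => V b i u y := fun b i =>
    (hV b i).comp measurable_prodMk_right
  rw [lintegral_finsetSum _ fun b _ =>
    (Finset.measurable_fun_sum _ fun i _ => hsec b i).const_mul _]
  refine Finset.sum_congr rfl fun b _ => ?_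
  rw [lintegral_const_mul _ (Finset.measurable_fun_sum _ fun i _ => hsec b i),
    lintegral_finsetSum _ fun i _ => hsec b i]

lemma lintegral_lintegral_measure_compl :
    ∫⁻ u in Set.Ioi (0 : ℝ), ∫⁻ y in Set.Ioo (0 : ℝ) 1,
        ∑ b, ENNReal.ofReal (segmentWeight ν y b)
          * ∑ i, ν i (initialSegment (maxQuantile ν y) b ∪ Set.Iic u.toNNReal)ᶜ
      = ∫⁻ y in Set.Ioo (0 : ℝ) 1, ∑ b, ENNReal.ofReal (segmentWeight ν y b)
          * ∑ i, ∫⁻ x, markReward (markAccept ν) (y, b) x ∂(ν i) := by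
  have key := lintegral_lintegral_sum_mul_sum (μ := volume.restrict (Set.Ioi (0 : ℝ)))
    (ρ := volume.restrict (Set.Ioo (0 : ℝ) 1))
    (w := fun b y => ENNReal.ofReal (segmentWeight ν y b))
    (V := fun b i u y => ν i (initialSegment (maxQuantile ν y) b ∪ Set.Iic u.toNNReal)ᶜ)
    (fun b => (measurable_segmentWeight b).ennreal_ofReal)
    (fun b i => measurable_measure_compl_initialSegment_union b i)
  rw [key]
  simp only [lintegral_markReward]

/-- Rejecting below the randomized quantiles earns a `β (1 - ε)` fraction of the expected
maximum. -/
lemma ofReal_mul_lintegral_jointReal_le {ε : ℝ} (hε : ε < 1) (hν : ∀ j, 1 - ε ≤ (ν j).real {0}) :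
    ENNReal.ofReal (kertzConstant * (1 - ε))
        * ∫⁻ u in Set.Ioi (0 : ℝ), ENNReal.ofReal (1 - jointReal ν (Set.Iic u.toNNReal))
      ≤ ∑ i, ∫⁻ a, (∫⁻ x, markReward (markAccept ν) a x ∂(ν i))
          * ∏ j ∈ Finset.univ.erase i, ∫⁻ b, ∫⁻ x, markPass markRank (markAccept ν) a b x ∂(ν j)
            ∂(markLaw ν) ∂(markLaw ν) := by
  have hν' : ∀ j, 0 < (ν j).real {0} := fun j => lt_of_lt_of_le (by linarith) (hν j)
  have hβ := kertzConstant_pos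
  have hRm : ∀ i, Measurable fun a => ∫⁻ x, markReward (markAccept ν) a x ∂(ν i) := fun i =>
    (measurable_markReward measurableSet_markAccept).lintegral_prod_right'
  have hrm : Measurable fun a : ℝ × Bool => ENNReal.ofReal (kertzConstant * kertzRate a.1) :=
    ((continuous_kertzRate.measurable.comp measurable_fst).const_mul _).ennreal_ofReal
  have hRrm : ∀ i ∈ Finset.univ, Measurable fun a => (∫⁻ x, markReward (markAccept ν) a x ∂(ν i))
      * ENNReal.ofReal (kertzConstant * kertzRate a.1) := fun i _ => (hRm i).mul hrm
  calc ENNReal.ofReal (kertzConstant * (1 - ε))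
        * ∫⁻ u in Set.Ioi (0 : ℝ), ENNReal.ofReal (1 - jointReal ν (Set.Iic u.toNNReal))
      = ENNReal.ofReal kertzConstant * ∫⁻ u in Set.Ioi (0 : ℝ),
          ENNReal.ofReal ((1 - ε) * (1 - jointReal ν (Set.Iic u.toNNReal))) := by
        simp_rw [ENNReal.ofReal_mul (show 0 ≤ 1 - ε by linarith)]
        rw [lintegral_const_mul' _ _ ENNReal.ofReal_ne_top, ← mul_assoc,
          ENNReal.ofReal_mul hβ.le]
    _ ≤ ENNReal.ofReal kertzConstant * ∫⁻ u in Set.Ioi (0 : ℝ), ∫⁻ y in Set.Ioo (0 : ℝ) 1,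
          ∑ b, ENNReal.ofReal (segmentWeight ν y b)
            * ∑ i, ν i (initialSegment (maxQuantile ν y) b ∪ Set.Iic u.toNNReal)ᶜ := by
        gcongr with u
        exact ofReal_one_sub_jointReal_le hε hν u.toNNReal
    _ = ENNReal.ofReal kertzConstant * ∫⁻ y in Set.Ioo (0 : ℝ) 1,
          ∑ b, ENNReal.ofReal (segmentWeight ν y b)
            * ∑ i, ∫⁻ x, markReward (markAccept ν) (y, b) x ∂(ν i) := by
        rw [lintegral_lintegral_measure_compl]
    -- The density `1 / kertzRate` cancels `kertzRate` in the reach bound, leaving the weight `β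
    -- dy`.
    _ = ∑ i, ∫⁻ a, (∫⁻ x, markReward (markAccept ν) a x ∂(ν i))
          * ENNReal.ofReal (kertzConstant * kertzRate a.1) ∂(markLaw ν) := by
        rw [← lintegral_finsetSum _ hRrm,
          lintegral_markLaw (Finset.measurable_fun_sum _ hRrm),
          ← lintegral_const_mul' _ _ ENNReal.ofReal_ne_top]
        refine setLIntegral_congr_fun measurableSet_Ioo fun y hy => ?_
        have hr := kertzRate_pos hy.1.le hy.2.le
        simp only [← Finset.sum_mul, Finset.mul_sum (a := ENNReal.ofReal kertzConstant)]
        refine Finset.sum_congr rfl fun b _ => ?_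
        have hw := segmentWeight_nonneg hν' hy b
        have e : ENNReal.ofReal (segmentWeight ν y b / kertzRate y)
            * ENNReal.ofReal (kertzConstant * kertzRate y)
            = ENNReal.ofReal kertzConstant * ENNReal.ofReal (segmentWeight ν y b) := by
          rw [← ENNReal.ofReal_mul (div_nonneg hw hr.le), ← ENNReal.ofReal_mul hβ.le]
          congr 1
          field_simp
        rw [← mul_assoc, ← e]
        ring
    _ ≤ _ := by
        refine Finset.sum_le_sum fun i _ => lintegral_mono_ae ?_
        filter_upwards [ae_markLaw_mem_Ioo (ν := ν)] with a ha
        simp_rw [lintegral_markPass]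
        gcongr
        exact ofReal_mul_kertzRate_le_prod_lintegral_passProb hν' ha _

/-! ### From the laws back to the random variables, and the truncation at `δ`. -/

variable {Ω : Type*} [MeasurableSpace Ω]

lemma iSup_coe_eq_ofReal_sup (x : Fin n → ℝ≥0) :
    ⨆ i, (x i : ℝ≥0∞) = ENNReal.ofReal (Finset.univ.sup x : ℝ≥0) := by
  rw [ENNReal.ofReal_coe_nnreal, ENNReal.coe_finset_sup, Finset.sup_univ_eq_iSup]

/-- Layer-cake formula; by independence the distribution function of the maximum is the product of
the individual ones. -/
lemma prophetMAX_eq_lintegral_jointReal {μ : Measure Ω} [IsProbabilityMeasure μ]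
    {X : Fin n → Ω → ℝ≥0} (hX : ∀ i, Measurable (X i)) (hind : iIndepFun X μ) :
    prophetMAX X μ = ∫⁻ u in Set.Ioi (0 : ℝ),
      ENNReal.ofReal (1 - jointReal (fun j => μ.map (X j)) (Set.Iic u.toNNReal)) := by
  unfold prophetMAX
  have hm : Measurable fun ω => ((Finset.univ.sup fun i => X i ω : ℝ≥0) : ℝ) := by
    have h : Measurable (Finset.univ.sup X) :=
      Finset.sup_induction measurable_const (fun f hf g hg => hf.sup hg) fun i _ => hX i
    simpa only [Finset.sup_apply] using h.coe_nnreal_real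
  simp_rw [iSup_coe_eq_ofReal_sup]
  rw [lintegral_eq_lintegral_meas_lt μ (Filter.Eventually.of_forall fun ω => NNReal.coe_nonneg _)
    hm.aemeasurable]
  refine setLIntegral_congr_fun measurableSet_Ioi fun u hu => ?_
  have hcompl : {ω | u < ((Finset.univ.sup fun i => X i ω : ℝ≥0) : ℝ)}
      = (⋂ i ∈ Finset.univ, X i ⁻¹' Set.Iic u.toNNReal)ᶜ := by
    ext ω
    rw [Set.mem_ofPred_eq, ← Real.toNNReal_lt_iff_lt_coe (Set.mem_Ioi.1 hu).le, ← not_le,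
      Finset.sup_le_iff]
    simp
  have hms : MeasurableSet (⋂ i ∈ Finset.univ, X i ⁻¹' Set.Iic u.toNNReal) :=
    Finset.measurableSet_biInter _ fun i _ => hX i measurableSet_Iic
  simp only [hcompl]
  rw [← ofReal_measureReal, probReal_compl_eq_one_sub hms, measureReal_def,
    hind.measure_inter_preimage_eq_mul Finset.univ fun _ _ => measurableSet_Iic,
    ENNReal.toReal_prod, jointReal]
  congr 2
  refine Finset.prod_congr rfl fun i _ => ?_
  rw [map_measureReal_apply (hX i) measurableSet_Iic, measureReal_def]

/-- If every box is nonzero with probability at most `ε`, some stopping rule for the random order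
earns a `β (1 - ε)` fraction of the expected maximum. -/
theorem exists_stoppingTime_of_measure_pos_le {μ : Measure Ω} [IsProbabilityMeasure μ]
    {X : Fin n → Ω → ℝ≥0} (hX : ∀ i, Measurable (X i)) (hind : iIndepFun X μ) {ε : ℝ≥0}
    (hε : ε < 1) (hsmall : ∀ i, μ {ω | 0 < X i ω} ≤ ε) :
    ∃ τ, IsStoppingTime (onlineFiltration X hX) τ ∧
      ENNReal.ofReal (kertzConstant * (1 - ε)) * prophetMAX X μ ≤ expectedReward X μ τ := by
  -- Derandomization needs a finite mean. If some box has infinite expectation, waiting for it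
  -- already earns infinity.
  by_cases htop : ∃ i, ∫⁻ ω, X i ω ∂μ = ∞
  · obtain ⟨i, hi⟩ := htop
    obtain ⟨τ, hτ, hle⟩ := exists_stoppingTime_lintegral_le hX μ i
    exact ⟨τ, hτ, le_top.trans (hi ▸ hle)⟩
  push Not at htop
  set ν : Fin n → Measure ℝ≥0 := fun j => μ.map (X j) with hνdef
  have hprob : ∀ j, IsProbabilityMeasure (ν j) := fun j =>
    Measure.isProbabilityMeasure_map (hX j).aemeasurable
  have hε' : (ε : ℝ) < 1 := hε
  have hν : ∀ j, 1 - (ε : ℝ) ≤ (ν j).real {0} := by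
    intro j
    have hz : MeasurableSet (X j ⁻¹' {0}) := hX j (measurableSet_singleton 0)
    have hc : (X j ⁻¹' {0})ᶜ = {ω | 0 < X j ω} := by
      ext ω
      simp [pos_iff_ne_zero]
    have h := ENNReal.toReal_mono ENNReal.coe_ne_top (hsmall j)
    rw [← hc, ← measureReal_def, probReal_compl_eq_one_sub hz, ENNReal.coe_toReal] at h
    rw [map_measureReal_apply (hX j) (measurableSet_singleton 0)]
    linarith
  have hprobLaw : IsProbabilityMeasure (markLaw ν) :=
    isProbabilityMeasure_markLaw fun j => lt_of_lt_of_le (by linarith) (hν j)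
  have hfin : ∫⁻ m, ∫⁻ ω, ∑ i, markGain markRank (markAccept ν) m (fun j => X j ω) i ∂μ
      ∂(Measure.pi fun _ : Fin n => markLaw ν) ≠ ∞ := by
    refine ne_top_of_le_ne_top (b := ∑ i, ∫⁻ ω, X i ω ∂μ)
      (ENNReal.sum_ne_top.2 fun i _ => htop i) ?_
    calc _ ≤ ∫⁻ _ : Fin n → ℝ × Bool, ∫⁻ ω, ∑ i, (X i ω : ℝ≥0∞) ∂μ
          ∂(Measure.pi fun _ : Fin n => markLaw ν) :=
          lintegral_mono fun m => lintegral_mono fun ω =>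
            Finset.sum_le_sum fun i _ => markGain_le _ _ _ _ _
      _ = ∑ i, ∫⁻ ω, X i ω ∂μ := by
          rw [lintegral_const, measure_univ, mul_one,
            lintegral_finsetSum _ fun i _ => (hX i).coe_nnreal_ennreal]
  obtain ⟨τ, hτ, hle⟩ := exists_stoppingTime_of_marks measurable_markRank
    measurableSet_markAccept hX μ (markLaw ν) hfin
  refine ⟨τ, hτ, le_trans ?_ hle⟩
  rw [lintegral_lintegral_sum_markGain measurable_markRank measurableSet_markAccept hX hind,
    prophetMAX_eq_lintegral_jointReal hX hind]
  refine (ofReal_mul_lintegral_jointReal_le hε' hν).trans_eq ?_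
  have hR : ∀ i a, ∫⁻ x, markReward (markAccept ν) a x ∂(ν i)
      = ∫⁻ ω, markReward (markAccept ν) a (X i ω) ∂μ := fun i a =>
    lintegral_map ((measurable_markReward measurableSet_markAccept).comp
      (measurable_prodMk_left (x := a))) (hX i)
  have hP : ∀ j a b, ∫⁻ x, markPass markRank (markAccept ν) a b x ∂(ν j)
      = ∫⁻ ω, markPass markRank (markAccept ν) a b (X j ω) ∂μ := fun j a b =>
    lintegral_map ((measurable_markPass measurable_markRank measurableSet_markAccept).comp
      ((measurable_prodMk_left (x := a)).comp (measurable_prodMk_left (x := b)))) (hX j)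
  simp_rw [hR, hP]

lemma prophetMAX_le_prophetMAX_sub_add (X : Fin n → Ω → ℝ≥0) (μ : Measure Ω)
    [IsProbabilityMeasure μ] (δ : ℝ≥0) :
    prophetMAX X μ ≤ prophetMAX (fun i ω => X i ω - δ) μ + δ := by
  calc prophetMAX X μ ≤ ∫⁻ ω, (⨆ i, ((X i ω - δ : ℝ≥0) : ℝ≥0∞)) + δ ∂μ := by
        refine lintegral_mono fun ω => iSup_le fun i => ?_
        refine le_trans ?_ (add_le_add_left
          (le_iSup (fun i => ((X i ω - δ : ℝ≥0) : ℝ≥0∞)) i) (δ : ℝ≥0∞))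
        rw [← ENNReal.coe_add]
        exact ENNReal.coe_le_coe.2 le_tsub_add
    _ = prophetMAX (fun i ω => X i ω - δ) μ + δ := by
        rw [lintegral_add_right _ measurable_const, lintegral_const, measure_univ, mul_one]
        rfl

lemma expectedReward_mono {X Y : Fin n → Ω → ℝ≥0} (h : ∀ i ω, Y i ω ≤ X i ω) (μ : Measure Ω)
    (τ : Equiv.Perm (Fin n) × Ω → WithTop (Fin n)) :
    expectedReward Y μ τ ≤ expectedReward X μ τ := by
  refine lintegral_mono fun p => ENNReal.coe_le_coe.2 ?_
  cases τ p with
  | top => exact le_rfl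
  | coe k => exact h _ _

/-- The truncated difference `X i - δ` is positive exactly when `X i > δ`, and truncation lowers the
expected maximum by at most `δ`. The same rule earns no less on the original values. -/
theorem exists_stoppingTime_of_isSmall {μ : Measure Ω} [IsProbabilityMeasure μ]
    {X : Fin n → Ω → ℝ≥0} (hX : ∀ i, Measurable (X i)) (hind : iIndepFun X μ) {ε δ : ℝ≥0}
    (hsmall : ∀ i, IsSmall ε δ (X i) μ) :
    ∃ τ, IsStoppingTime (onlineFiltration X hX) τ ∧
      ENNReal.ofReal (kertzConstant - ε) * prophetMAX X μ ≤ expectedReward X μ τ + δ := by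
  rcases le_or_gt 1 ε with hε | hε
  · refine ⟨firstHit X fun _ => ∅, isStoppingTime_firstHit hX fun _ => MeasurableSet.empty, ?_⟩
    have h1 : (1 : ℝ) ≤ ε := hε
    rw [ENNReal.ofReal_of_nonpos (by linarith [kertzConstant_lt_one]), zero_mul]
    exact zero_le
  have hsub : Measurable fun x : ℝ≥0 => x - δ := measurable_id.sub_const δ
  have hY : ∀ i, Measurable fun ω => X i ω - δ := fun i => hsub.comp (hX i)
  obtain ⟨τ, hτ, hle⟩ := exists_stoppingTime_of_measure_pos_le hY
    (hind.comp (fun _ x => x - δ) fun _ => hsub) hε fun i => by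
      simpa only [IsSmall, tsub_pos_iff_lt] using hsmall i
  refine ⟨τ, isStoppingTime_of_comp hX hsub hY hτ, ?_⟩
  have hβ0 := kertzConstant_pos
  have hβ1 := kertzConstant_lt_one
  have hε0 : (0 : ℝ) ≤ ε := ε.2
  calc ENNReal.ofReal (kertzConstant - ε) * prophetMAX X μ
      ≤ ENNReal.ofReal (kertzConstant - ε) * (prophetMAX (fun i ω => X i ω - δ) μ + δ) := by
        gcongr
        exact prophetMAX_le_prophetMAX_sub_add X μ δ
    _ = ENNReal.ofReal (kertzConstant - ε) * prophetMAX (fun i ω => X i ω - δ) μ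
          + ENNReal.ofReal (kertzConstant - ε) * δ := mul_add _ _ _
    _ ≤ ENNReal.ofReal (kertzConstant * (1 - ε)) * prophetMAX (fun i ω => X i ω - δ) μ
          + 1 * δ := by
        gcongr
        -- `β - ε ≤ β * (1 - ε)` because `β < 1`.
        · nlinarith
        · exact ENNReal.ofReal_le_one.2 (by linarith)
    _ ≤ expectedReward X μ τ + δ := by
        rw [one_mul]
        gcongr
        exact hle.trans (expectedReward_mono (fun i ω => tsub_le_self) μ τ)

end Main

theorem corollary3p5 :
    ∃ C : ℝ, 0 < C ∧
      ∀ (n : ℕ) (Ω : Type*) [MeasurableSpace Ω] (μ : Measure Ω) [IsProbabilityMeasure μ]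
        (X : Fin n → Ω → ℝ≥0) (hX : ∀ i, Measurable (X i)) (_ : iIndepFun X μ)
        (ε δ : ℝ≥0) (_ : ∀ i, IsSmall ε δ (X i) μ),
        ENNReal.ofReal (kertzConstant - C * ε) * prophetMAX X μ ≤ prophetOPT X hX μ + δ ∧
        ∃ τ : Equiv.Perm (Fin n) × Ω → WithTop (Fin n),
          IsStoppingTime (onlineFiltration X hX) τ ∧
          ENNReal.ofReal (kertzConstant - C * ε) * prophetMAX X μ
            ≤ expectedReward X μ τ + δ := by
  -- `C = 1` suffices: the true loss is `β * ε`, which is at most `ε`.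
  refine ⟨1, one_pos, fun n Ω _ μ _ X hX hind ε δ hsmall => ?_⟩
  rw [one_mul]
  obtain ⟨τ, hτ, hle⟩ := exists_stoppingTime_of_isSmall hX hind hsmall
  refine ⟨hle.trans ?_, τ, hτ, hle⟩
  gcongr
  exact le_iSup₂_of_le τ hτ le_rfl
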